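/- Let $n\ge 0$, let $T$ be a triangulation of a convex $(n+3)$-gon (a maximal set of pairwise non-crossing diagonals), and let $\gamma$ be a diagonal of the polygon that is not in $T$. The edges of $T$ are its diagonals together with the boundary segments of the polygon; there are $2n+3$ of them, and they index the coordinates $x_e$ of $\mathbb{R}^{2n+3}$. Let $D(\gamma)$ be the set of diagonals of $T$ crossed by $\gamma$. *Snake graph.* For $\tau\in D(\gamma)$ let $Q_\tau$ be the quadrilateral formed by the two triangles of $T$ that have $\tau$ as a side. Take one tile for every $\tau\in D(\gamma)$, namely a copy of the boundary $4$-cycle of $Q_\tau$, each edge being labelled by the corresponding edge of $T$. If $\tau,\tau'$ are consecutive among the diagonals crossed along $\gamma$, they are two sides of a triangle of $T$; glue the tiles of $\tau$ and $\tau'$ along the edge labelled by the third side of this triangle, identifying endpoints that represent the same vertex of the polygon. The resulting graph with edge labels is the snake graph $G_{T,\gamma}$. Two vertices of $G_{T,\gamma}$ are equivalent if they correspond to the same vertex of the polygon; $[v]$ is the equivalence class of $v$, and $E_{[v]}$ is the set of distinct labels of edges of $G_{T,\gamma}$ incident to some member of $[v]$. The characteristic vector of a perfect matching $M$ of $G_{T,\gamma}$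 has as its coordinate $x_e$ the number of edges of $M$ labelled $e$, and $P(G_{T,\gamma})\subset\mathbb{R}^{2n+3}$ is the convex hull of the characteristic vectors of all perfect matchings of $G_{T,\gamma}$. *The subgraph $T'$.* Let $T'$ have as vertices all vertices of the polygon incident to a diagonal in $\{\gamma\}\cup D(\gamma)$, and as edges all edges of $T$ that join two of these vertices. For a vertex $w$ of $T'$ let $\mathrm{diagonals}(w)$ be the set of elements of $\{\gamma\}\cup D(\gamma)$ incident to $w$. **Proposition.** The affine hull of $P(G_{T,\gamma})$ is the solution set of the equations (i) $x_e=0$ for each edge $e$ of $T$ that does not appear as a label in $G_{T,\gamma}$, (ii) $\sum_{e\in E_{[v]}}x_e=|[v]|$ for each vertex equivalence class $[v]$ of $G_{T,\gamma}$, and it is also the solution set of the equations (iii) $x_e=0$ for each edge $e$ of $T$ that is not in $T'$, (iv) $\sum_{e\ni w}x_e=|\mathrm{diagonals}(w)|$, the sum over the edges $e$ of $T'$ incident to $w$, for each vertex $w$ of $T'$. The equations (iii)–(iv) are linearly independent, none of them can be omitted without changing the solution set, and there are exactly $2n+3-|D(\gamma)|$ of them. If $|D(\gamma)|\ge 2$,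 the same holds for the equations (i)–(ii). -/

import Mathlib

/-! Triangulated polygons, snake graphs and their matching polytopes.
The vertices of the `(n+3)`-gon are the elements of `Fin (n + 3)` in cyclic order; a segment joining
two vertices is an element of `Sym2 (Fin (n + 3))`.  `sbtw a c b` says that `c` lies strictly
inside the arc that runs from `a` to `b` in the positive direction. -/

namespace SnakePolytope

/-- The boundary segments of the `(n+3)`-gon. -/
def boundarySegments (n : ℕ) : Finset (Sym2 (Fin (n + 3))) :=
  Finset.univ.image fun i => s(i, i + 1)

/-- A diagonal joins two distinct vertices that are not adjacent on the boundary. -/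
def IsDiagonal {n : ℕ} (e : Sym2 (Fin (n + 3))) : Prop :=
  ¬ e.IsDiag ∧ e ∉ boundarySegments n

/-- Two segments cross (in an interior point) when their endpoints strictly interleave. -/
def Crosses {n : ℕ} (e f : Sym2 (Fin (n + 3))) : Prop :=
  ∃ a b c d, e = s(a, b) ∧ f = s(c, d) ∧ sbtw a c b ∧ sbtw b d a

/-- A triangulation of the `(n+3)`-gon: a maximal set of pairwise non-crossing diagonals. -/
structure Triangulation (n : ℕ) where
  diagonals : Finset (Sym2 (Fin (n + 3)))
  isDiagonal : ∀ e ∈ diagonals, IsDiagonal e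
  noncrossing : ∀ e ∈ diagonals, ∀ f ∈ diagonals, ¬ Crosses e f
  maximal : ∀ e, IsDiagonal e → (∀ f ∈ diagonals, ¬ Crosses e f) → e ∈ diagonals

namespace Triangulation

variable {n : ℕ} (T : Triangulation n)

/-- The edges of `T`: its diagonals and the boundary segments of the polygon. -/
def edges : Finset (Sym2 (Fin (n + 3))) := T.diagonals ∪ boundarySegments n

/-- The edges of `T` as a type; it indexes the coordinates `x_e`. -/
abbrev Edge : Type := {e : Sym2 (Fin (n + 3)) // e ∈ T.edges}

/-- `x`, `y`, `z` are the vertices of a triangle of `T`. -/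
def IsTriangle (x y z : Fin (n + 3)) : Prop :=
  x ≠ y ∧ y ≠ z ∧ x ≠ z ∧ s(x, y) ∈ T.edges ∧ s(y, z) ∈ T.edges ∧ s(x, z) ∈ T.edges

/-- The vertices of the quadrilateral `Q_τ` formed by the two triangles of `T` with side `τ`. -/
def quadVertices (τ : Sym2 (Fin (n + 3))) : Set (Fin (n + 3)) :=
  {p | ∃ x y z, T.IsTriangle x y z ∧ τ = s(x, y) ∧ (p = x ∨ p = y ∨ p = z)}

/-- The sides of the quadrilateral `Q_τ`. -/
def quadSides (τ : Sym2 (Fin (n + 3))) : Set (Sym2 (Fin (n + 3))) :=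
  {e | ∃ x y z, T.IsTriangle x y z ∧ τ = s(x, y) ∧ e = s(x, z)}

/-! From here on `γ` is the segment from `a` to `b`, oriented from `a` to `b`. -/

/-- `D(γ)`: the set of diagonals of `T` that `γ` crosses. -/
def crossed (a b : Fin (n + 3)) : Set (Sym2 (Fin (n + 3))) :=
  {τ | τ ∈ T.diagonals ∧ Crosses s(a, b) τ}

/-- For non-crossing segments `τ`, `τ'` that both cross `γ`: on the way from `a` to `b`,
`γ` meets `τ` before it meets `τ'`.  On neither side of `γ` is the endpoint of `τ'` strictly
closer to `a` than the endpoint of `τ`. -/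
def Before (a b : Fin (n + 3)) (τ τ' : Sym2 (Fin (n + 3))) : Prop :=
  τ ≠ τ' ∧ ∃ c d c' d', τ = s(c, d) ∧ τ' = s(c', d') ∧
    (sbtw a c b ∧ sbtw b d a) ∧ (sbtw a c' b ∧ sbtw b d' a) ∧ ¬ sbtw a c' c ∧ ¬ sbtw d d' a

/-- `τ` and `τ'` are consecutive among the diagonals of `T` crossed by `γ`. -/
def Consecutive (a b : Fin (n + 3)) (τ τ' : Sym2 (Fin (n + 3))) : Prop :=
  τ ∈ T.crossed a b ∧ τ' ∈ T.crossed a b ∧ Before a b τ τ' ∧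
    ¬ ∃ σ ∈ T.crossed a b, Before a b τ σ ∧ Before a b σ τ'

/-- The corners of the tiles: there is one tile for every crossed diagonal `τ`, it is a copy
of the quadrilateral `Q_τ`, and a corner of it is a vertex of `Q_τ`. -/
structure Corner (a b : Fin (n + 3)) where
  tile : Sym2 (Fin (n + 3))
  point : Fin (n + 3)
  tile_mem : tile ∈ T.crossed a b
  point_mem : point ∈ T.quadVertices tile

variable {T} in
/-- The gluing of consecutive tiles `τ`, `τ'` along the edge labelled by the third side of the
triangle of `T` with sides `τ`, `τ'`.  As consecutive tiles are drawn with opposite orientations,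
the endpoints that are identified are the ones that represent the same vertex of the polygon. -/
def Glue {a b : Fin (n + 3)} (c c' : T.Corner a b) : Prop :=
  T.Consecutive a b c.tile c'.tile ∧ c.point = c'.point ∧
    ∃ x y z, T.IsTriangle x y z ∧ c.tile = s(x, y) ∧ c'.tile = s(x, z) ∧ c.point ∈ s(y, z)

/-- The vertices of the snake graph `G_{T,γ}`: the corners of the tiles, after gluing. -/
def SnakeVertex (a b : Fin (n + 3)) : Type := Quot (Glue : T.Corner a b → T.Corner a b → Prop)

variable {T} in
/-- The vertex of the polygon that a vertex of the snake graph corresponds to. -/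
def mark {a b : Fin (n + 3)} : T.SnakeVertex a b → Fin (n + 3) :=
  Quot.lift (fun c => c.point) fun _ _ h => h.2.1

/-- The snake graph `G_{T,γ}`: its edges are the sides of the tiles (the tile diagonals are
removed). -/
def snakeGraph (a b : Fin (n + 3)) : SimpleGraph (T.SnakeVertex a b) where
  Adj u v := ∃ c c' : T.Corner a b, c.tile = c'.tile ∧ s(c.point, c'.point) ∈ T.quadSides c.tile ∧
    u = Quot.mk _ c ∧ v = Quot.mk _ c'
  symm := ⟨by
    rintro u v ⟨c, c', h, hs, hu, hv⟩
    exact ⟨c', c, h.symm, by rwa [← h, Sym2.eq_swap], hv, hu⟩⟩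
  loopless := ⟨by
    rintro u ⟨c, c', -, ⟨x, y, z, hT, -, he⟩, hu, hv⟩
    have h : c.point = c'.point := congrArg mark (hu.symm.trans hv)
    rw [h] at he
    rcases Sym2.eq_iff.1 he with ⟨h1, h2⟩ | ⟨h1, h2⟩
    · exact hT.2.2.1 (h1.symm.trans h2)
    · exact hT.2.2.1 (h2.symm.trans h1)⟩

variable {T} in
/-- The label of an edge of the snake graph: the side of `Q_τ` that it is a copy of. -/
def label {a b : Fin (n + 3)} (ε : Sym2 (T.SnakeVertex a b)) : Sym2 (Fin (n + 3)) := ε.map mark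

variable {T} in
/-- The characteristic vector of a set of edges of the snake graph (here given as the edges of a
subgraph `M`): the coordinate `x_e` counts the edges labelled `e`. -/
noncomputable def charVector {a b : Fin (n + 3)} (M : (T.snakeGraph a b).Subgraph) : T.Edge → ℝ :=
  fun e => ({ε | ε ∈ M.edgeSet ∧ label ε = e.1}.ncard : ℝ)

/-- `P(G_{T,γ})`: the convex hull of the characteristic vectors of all perfect matchings of the
snake graph. -/
def matchingPolytope (a b : Fin (n + 3)) : Set (T.Edge → ℝ) :=
  convexHull ℝ {x | ∃ M : (T.snakeGraph a b).Subgraph, M.IsPerfectMatching ∧ x = charVector M}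

/-- Vertices of the snake graph are equivalent if they correspond to the same vertex of the
polygon. -/
def vertexSetoid (a b : Fin (n + 3)) : Setoid (T.SnakeVertex a b) := Setoid.ker mark

/-- The vertex equivalence classes `[v]`. -/
abbrev VertexClass (a b : Fin (n + 3)) : Type := Quotient (T.vertexSetoid a b)

variable {T} in
/-- The members of a vertex equivalence class. -/
def VertexClass.members {a b : Fin (n + 3)} (C : T.VertexClass a b) : Set (T.SnakeVertex a b) :=
  {v | (⟦v⟧ : T.VertexClass a b) = C}

variable {T} in
/-- `E_{[v]}`: the set of labels of the edges of the snake graph incident to a member of `[v]`. -/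
def VertexClass.labels {a b : Fin (n + 3)} (C : T.VertexClass a b) : Set T.Edge :=
  {e | ∃ v ∈ C.members, ∃ ε ∈ (T.snakeGraph a b).incidenceSet v, label ε = e.1}

/-- The labels that appear in the snake graph. -/
def snakeLabels (a b : Fin (n + 3)) : Set T.Edge :=
  {e | ∃ ε ∈ (T.snakeGraph a b).edgeSet, label ε = e.1}

/-- The set `γ ∪ D(γ)`. -/
def crossedWith (a b : Fin (n + 3)) : Set (Sym2 (Fin (n + 3))) := insert s(a, b) (T.crossed a b)

/-- The vertices of `T'`: those incident to a diagonal in `γ ∪ D(γ)`. -/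
def subVertices (a b : Fin (n + 3)) : Set (Fin (n + 3)) := {w | ∃ e ∈ T.crossedWith a b, w ∈ e}

/-- The edges of `T'`: the edges of `T` that join two vertices of `T'`. -/
def subEdges (a b : Fin (n + 3)) : Set T.Edge := {e | ∀ w ∈ e.1, w ∈ T.subVertices a b}

/-- `diagonals(w)`: the set of diagonals in `γ ∪ D(γ)` incident to `w`. -/
def diagonalsAt (a b w : Fin (n + 3)) : Set (Sym2 (Fin (n + 3))) :=
  {e | e ∈ T.crossedWith a b ∧ w ∈ e}

/-- The linear form `∑_{e ∈ S} x_e`. -/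
noncomputable def sumForm (S : Set T.Edge) : Module.Dual ℝ (T.Edge → ℝ) :=
  open Classical in ∑ e : T.Edge with e ∈ S, LinearMap.proj e

end Triangulation

/-- A system of linear equations `form i x = rhs i` on the real vector space `W`. -/
structure LinearSystem (W : Type) [AddCommGroup W] [Module ℝ W] where
  Index : Type
  form : Index → Module.Dual ℝ W
  rhs : Index → ℝ

namespace LinearSystem

variable {W : Type} [AddCommGroup W] [Module ℝ W] (L : LinearSystem W)

/-- The set of solutions of the system. -/
def solutions : Set W := {x | ∀ i, L.form i x = L.rhs i}

/-- The equations of the system are linearly independent. -/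
def Independent : Prop := LinearIndependent ℝ L.form

/-- No equation can be left out without changing the set of solutions. -/
def Irredundant : Prop := ∀ i, {x | ∀ j, j ≠ i → L.form j x = L.rhs j} ≠ L.solutions

end LinearSystem

namespace Triangulation

variable {n : ℕ} (T : Triangulation n)

/-- The equations read off the snake graph: `x_e = 0` for each edge `e` of `T` that does not
appear in the snake graph, and `∑_{e ∈ E_[v]} x_e = |[v]|` for each vertex class `[v]`. -/
noncomputable def snakeSystem (a b : Fin (n + 3)) : LinearSystem (T.Edge → ℝ) where
  Index := {e : T.Edge // e ∉ T.snakeLabels a b} ⊕ T.VertexClass a b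
  form := Sum.elim (fun e => LinearMap.proj e.1) fun C => T.sumForm C.labels
  rhs := Sum.elim (fun _ => 0) fun C => (C.members.ncard : ℝ)

/-- The equations read off the triangulation: `x_e = 0` for each edge `e` of `T \ T'`, and
`∑_{e ∋ w} x_e = |diagonals(w)|` (sum over edges of `T'`) for each vertex `w` of `T'`. -/
noncomputable def triangulationSystem (a b : Fin (n + 3)) : LinearSystem (T.Edge → ℝ) where
  Index := {e : T.Edge // e ∉ T.subEdges a b} ⊕ {w : Fin (n + 3) // w ∈ T.subVertices a b}
  form := Sum.elim (fun e => LinearMap.proj e.1) fun w =>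
    T.sumForm {e | e ∈ T.subEdges a b ∧ w.1 ∈ e.1}
  rhs := Sum.elim (fun _ => 0) fun w => ((T.diagonalsAt a b w.1).ncard : ℝ)

end Triangulation

end SnakePolytope

/-! The diagonals `τ₁, …, τ_d` of `T` crossed by `γ` are nested, so `γ` meets them in a definite
order (`Strip`, `exists_strip`), and consecutive ones share an endpoint. Adding the degenerate
diagonals `aa` and `bb` at the ends gives sides `0, …, d + 1`. The proof rests on two
descriptions of this strip of triangles.

*The subgraph `T'` is a two-tree.* It starts with the triangle at `a`, and each `τ_k`
contributes one new vertex joined to both ends of `τ_k`; no other edge of `T` joins two of its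
vertices, as it would cross some `τ_k` (`Strip.mem_sides`). This gives `d + 3` vertices and
`2d + 3` edges, hence the number of equations of `triangulationSystem`. They are independent because
a vertex weight `y` with `y u + y v = 0` on all edges vanishes on the first triangle and so
everywhere (`Strip.eq_zero_of_add_eq_zero`). Conversely an edge weight whose alternating sum
around every quadrilateral `Q_τ` vanishes has the form `y u + y v`
(`Strip.exists_vertex_weight`).

*The snake graph is layered.* Its vertices correspond to the pairs `(k, x)` with `x` an endpoint
of side `k`; vertices `(k, x)` and `(k + 1, y)` with `x ≠ y` are joined by an edge labelled `xy`
(`Strip.vertex_ext`, `Strip.adj_of_level`). So a vertex `w` of the polygon is represented once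
for each diagonal of `γ ∪ D(γ)` at `w` (`Strip.ncard_mark_eq`), and choosing one edge between
any two consecutive layers such that the chosen edges meet every vertex gives a perfect matching
(`Strip.layerMatching`). For every tile there are two such matchings that differ only in that
tile.

By double counting the characteristic vectors solve `triangulationSystem`. A functional that is
constant on them has vanishing alternating sums around all tiles (`Strip.tile_relation`), so it
is a combination of the forms of the system; by duality the characteristic vectors span the
solution space. The equations of `snakeSystem` are the same up to the variables that are no
labels, which vanish on the matchings; for `d ≥ 2` every edge of `T'` is a label and the
equations coincide. -/

namespace SnakePolytope

/-! ### Cyclic order on the polygon and triangles of a triangulation -/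

/-- The number of steps from `o` to `x` in the positive direction. Reading the vertices in this
coordinate turns statements about cyclic order into linear arithmetic over `ℕ`. -/
def pos {n : ℕ} (o x : Fin (n + 3)) : ℕ := (x - o).val

section Position

variable {n : ℕ}

lemma pos_eq (o x : Fin (n + 3)) :
    pos o x = if o.val ≤ x.val then x.val - o.val else n + 3 + x.val - o.val := by
  have h1 := o.isLt
  have h2 := x.isLt
  unfold pos
  rw [Fin.val_sub]
  split_ifs with h
  · rw [show n + 3 - o.val + x.val = (x.val - o.val) + (n + 3) by omega, Nat.add_mod_right,
      Nat.mod_eq_of_lt (by omega)]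
  · rw [Nat.mod_eq_of_lt (by omega)]
    omega

@[simp] lemma pos_self (o : Fin (n + 3)) : pos o o = 0 := by simp [pos]

lemma pos_inj {o x y : Fin (n + 3)} : pos o x = pos o y ↔ x = y := by
  unfold pos
  rw [Fin.val_inj, sub_left_inj]

lemma sbtw_iff_val {x y z : Fin (n + 3)} : sbtw x y z ↔
    (x.val < y.val ∧ y.val < z.val) ∨ (y.val < z.val ∧ z.val < x.val) ∨
      (z.val < x.val ∧ x.val < y.val) := Iff.rfl

lemma sbtw_iff_pos (o : Fin (n + 3)) {x y z : Fin (n + 3)} : sbtw x y z ↔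
    (pos o x < pos o y ∧ pos o y < pos o z) ∨ (pos o y < pos o z ∧ pos o z < pos o x) ∨
      (pos o z < pos o x ∧ pos o x < pos o y) := by
  rw [sbtw_iff_val, pos_eq, pos_eq, pos_eq]
  have := o.isLt
  have := x.isLt
  have := y.isLt
  have := z.isLt
  split_ifs <;> omega

lemma val_add_one (i : Fin (n + 3)) :
    (i + 1).val = if i.val = n + 2 then 0 else i.val + 1 := by
  rw [Fin.val_add_one]
  simp [Fin.ext_iff]

lemma not_sbtw_add_one (i u : Fin (n + 3)) : ¬ sbtw i u (i + 1) := by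
  rw [sbtw_iff_val, val_add_one]
  have := u.isLt
  have := i.isLt
  split_ifs <;> omega

lemma sbtw_add_one {x y z : Fin (n + 3)} (h : sbtw x z y) : sbtw x (x + 1) y := by
  rw [sbtw_iff_val] at h ⊢
  rw [val_add_one]
  have := x.isLt
  have := y.isLt
  have := z.isLt
  split_ifs <;> omega

lemma crosses_mk {x y u v : Fin (n + 3)} : Crosses s(x, y) s(u, v) ↔
    (sbtw x u y ∧ sbtw y v x) ∨ (sbtw x v y ∧ sbtw y u x) := by
  constructor
  · rintro ⟨a, b, c, d, h1, h2, h3, h4⟩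
    rw [Sym2.eq_iff] at h1 h2
    rcases h1 with ⟨rfl, rfl⟩ | ⟨rfl, rfl⟩ <;> rcases h2 with ⟨rfl, rfl⟩ | ⟨rfl, rfl⟩ <;> tauto
  · rintro (⟨h1, h2⟩ | ⟨h1, h2⟩)
    · exact ⟨x, y, u, v, rfl, rfl, h1, h2⟩
    · exact ⟨x, y, v, u, rfl, Sym2.eq_swap, h1, h2⟩

lemma crosses_symm {e f : Sym2 (Fin (n + 3))} (h : Crosses e f) : Crosses f e := by
  obtain ⟨a, b, c, d, rfl, rfl, h1, h2⟩ := h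
  refine ⟨d, c, a, b, Sym2.eq_swap, rfl, ?_, ?_⟩ <;>
  · rw [sbtw_iff_pos a] at *
    omega

lemma mem_boundarySegments {e : Sym2 (Fin (n + 3))} :
    e ∈ boundarySegments n ↔ ∃ i, s(i, i + 1) = e := by
  simp [boundarySegments]

lemma not_crosses_boundary {e f : Sym2 (Fin (n + 3))} (he : e ∈ boundarySegments n) :
    ¬ Crosses e f := by
  obtain ⟨i, rfl⟩ := mem_boundarySegments.1 he
  induction f with | _ u v
  rw [crosses_mk]
  rintro (⟨h, -⟩ | ⟨h, -⟩) <;> exact not_sbtw_add_one _ _ h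

end Position

namespace Triangulation

variable {n : ℕ} {T : Triangulation n}

lemma mem_edges {e : Sym2 (Fin (n + 3))} :
    e ∈ T.edges ↔ e ∈ T.diagonals ∨ e ∈ boundarySegments n := by simp [edges]

lemma edges_not_crosses {e f : Sym2 (Fin (n + 3))} (he : e ∈ T.edges) (hf : f ∈ T.edges) :
    ¬ Crosses e f := by
  rw [mem_edges] at he hf
  rcases he with he | he
  · rcases hf with hf | hf
    · exact T.noncrossing e he f hf
    · exact fun h => not_crosses_boundary hf (crosses_symm h)
  · exact not_crosses_boundary he

lemma edges_not_interleave {x y u v : Fin (n + 3)} (h : s(x, y) ∈ T.edges)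
    (h' : s(u, v) ∈ T.edges) : ¬ (sbtw x u y ∧ sbtw y v x) :=
  fun h1 => edges_not_crosses h h' (crosses_mk.2 (Or.inl h1))

lemma boundary_mem_edges (i : Fin (n + 3)) : s(i, i + 1) ∈ T.edges :=
  mem_edges.2 (Or.inr (mem_boundarySegments.2 ⟨i, rfl⟩))

lemma mem_edges_of_forall {x y : Fin (n + 3)} (hxy : x ≠ y)
    (h : ∀ u v, s(u, v) ∈ T.edges → sbtw x u y → sbtw y v x → False) : s(x, y) ∈ T.edges := by
  by_cases hb : s(x, y) ∈ boundarySegments n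
  · exact mem_edges.2 (Or.inr hb)
  · refine mem_edges.2 (Or.inl (T.maximal _ ⟨by simpa using hxy, hb⟩ ?_))
    intro f hf hc
    induction f with | _ u v
    rcases crosses_mk.1 hc with ⟨h1, h2⟩ | ⟨h1, h2⟩
    · exact h u v (mem_edges.2 (Or.inl hf)) h1 h2
    · exact h v u (mem_edges.2 (Or.inl (by rwa [Sym2.eq_swap]))) h1 h2

lemma not_isDiag_of_mem_edges {e : Sym2 (Fin (n + 3))} (he : e ∈ T.edges) : ¬ e.IsDiag := by
  rcases mem_edges.1 he with he | he
  · exact (T.isDiagonal e he).1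
  · obtain ⟨i, rfl⟩ := mem_boundarySegments.1 he
    simp

lemma ne_of_mem_edges {x y : Fin (n + 3)} (h : s(x, y) ∈ T.edges) : x ≠ y := by
  simpa using not_isDiag_of_mem_edges h

/-- An edge of a triangulation with a vertex on its positive side is a side of a triangle there:
its apex is the last neighbour of `x` before `y`. -/
lemma exists_apex {x y z : Fin (n + 3)} (hxy : s(x, y) ∈ T.edges) (hz : sbtw x z y) :
    ∃ m, sbtw x m y ∧ s(x, m) ∈ T.edges ∧ s(m, y) ∈ T.edges := by
  classical
  obtain ⟨m, hm, hmax⟩ := Finset.exists_max_image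
    (Finset.univ.filter fun m => sbtw x m y ∧ s(x, m) ∈ T.edges) (pos x)
    ⟨x + 1, by simpa using ⟨sbtw_add_one hz, boundary_mem_edges x⟩⟩
  simp only [Finset.mem_filter, Finset.mem_univ, true_and] at hm hmax
  obtain ⟨hm1, hm2⟩ := hm
  refine ⟨m, hm1, hm2, mem_edges_of_forall ?_ ?_⟩
  · rintro rfl
    rw [sbtw_iff_pos x] at hm1
    omega
  · intro u v huv hu hv
    have hx : v = x := by
      rw [← pos_inj (o := x), pos_self]
      have h1 := edges_not_interleave hxy huv
      have h2 := edges_not_interleave hm2 (u := v) (v := u) (by rwa [Sym2.eq_swap])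
      simp only [sbtw_iff_pos x, pos_self] at *
      omega
    subst hx
    have h3 := hmax u ⟨by simp only [sbtw_iff_pos v, pos_self] at *; omega,
      by rwa [Sym2.eq_swap]⟩
    simp only [sbtw_iff_pos v, pos_self] at *
    omega

/-- Two triangles on the same side of an edge would have crossing sides. -/
lemma apex_unique {x y z z' : Fin (n + 3)} (h : sbtw x z y) (h' : sbtw x z' y)
    (h1 : s(x, z) ∈ T.edges) (h2 : s(z, y) ∈ T.edges) (h1' : s(x, z') ∈ T.edges)
    (h2' : s(z', y) ∈ T.edges) : z = z' := by
  have e1 := edges_not_interleave h1' h2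
  have e2 := edges_not_interleave h1 h2'
  rw [← pos_inj (o := x)]
  simp only [sbtw_iff_pos x, pos_self] at *
  omega

end Triangulation
end SnakePolytope

namespace SnakePolytope

/-! ### The strip of triangles crossed by `γ` -/

lemma exists_strictMono_enumeration {α : Type*} [Nonempty α] (S : Finset α) (f : α → ℕ)
    (hf : Set.InjOn f S) : ∃ p : ℕ → α, (∀ k < S.card, p k ∈ S) ∧
      (∀ i j, i < j → j < S.card → f (p i) < f (p j)) ∧ ∀ q ∈ S, ∃ k < S.card, p k = q := by
  classical
  induction S using Finset.induction_on_max_value f with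
  | empty => exact ⟨fun _ => Classical.arbitrary α, by simp⟩
  | insert x s hx hmax ih =>
    obtain ⟨p, h1, h2, h3⟩ := ih (hf.mono (by simp))
    have hcard := Finset.card_insert_of_notMem hx
    refine ⟨fun k => if k = s.card then x else p k, ?_, ?_, ?_⟩
    · intro k hk
      by_cases h : k = s.card
      · simp [h]
      · simpa [h] using Or.inr (h1 k (by omega))
    · intro i j hij hj
      have hi : i ≠ s.card := by omega
      have hps := h1 i (by omega)
      by_cases h : j = s.card
      · simp only [h, hi, if_true, if_false]
        refine lt_of_le_of_ne (hmax _ hps) fun he => hx ?_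
        rwa [← hf (by simp [hps]) (by simp) he]
      · simpa only [h, hi, if_false] using h2 i j hij (by omega)
    · intro q hq
      rcases Finset.mem_insert.1 hq with rfl | hq
      · exact ⟨s.card, by omega, by simp⟩
      · obtain ⟨k, hk, rfl⟩ := h3 q hq
        exact ⟨k, by omega, by simp [hk.ne]⟩

variable {n : ℕ} {T : Triangulation n} {a b : Fin (n + 3)}

/-- The diagonals crossed by the segment from `a` to `b`, as pairs of a vertex on the positive arc
from `a` to `b` and a vertex on the arc from `b` to `a`. -/
def IsRung (T : Triangulation n) (a b l r : Fin (n + 3)) : Prop :=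
  s(l, r) ∈ T.edges ∧ sbtw a l b ∧ sbtw b r a

lemma mem_crossed_iff {τ : Sym2 (Fin (n + 3))} :
    τ ∈ T.crossed a b ↔ ∃ l r, τ = s(l, r) ∧ IsRung T a b l r := by
  constructor
  · rintro ⟨h, hc⟩
    induction τ with | _ u v
    rcases crosses_mk.1 hc with h' | h'
    · exact ⟨u, v, rfl, Triangulation.mem_edges.2 (Or.inl h), h'⟩
    · exact ⟨v, u, Sym2.eq_swap, Triangulation.mem_edges.2 (Or.inl (by rwa [Sym2.eq_swap])), h'⟩
  · rintro ⟨l, r, rfl, h, h'⟩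
    have hc : Crosses s(a, b) s(l, r) := crosses_mk.2 (Or.inl h')
    refine ⟨(Triangulation.mem_edges.1 h).resolve_right fun hb => ?_, hc⟩
    exact not_crosses_boundary hb (crosses_symm hc)

/-- The crossed diagonals are nested: two of them cannot be met in different orders on the two
sides of `γ`. -/
lemma IsRung.nested {l r l' r' : Fin (n + 3)} (h : IsRung T a b l r) (h' : IsRung T a b l' r')
    (hlt : pos a l < pos a l') : pos a r' ≤ pos a r := by
  have h1 := Triangulation.edges_not_interleave h.1 h'.1
  obtain ⟨-, h2, h3⟩ := h
  obtain ⟨-, h4, h5⟩ := h'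
  simp only [sbtw_iff_pos a, pos_self] at *
  omega

/-- The triangle behind a crossed diagonal, seen from `a`, leads to another crossed diagonal or
ends in `b`. -/
lemma IsRung.next {l r : Fin (n + 3)} (h : IsRung T a b l r) :
    (∃ z, pos a l < pos a z ∧ s(l, z) ∈ T.edges ∧ IsRung T a b z r) ∨
    (∃ z, pos a z < pos a r ∧ s(r, z) ∈ T.edges ∧ IsRung T a b l z) ∨
    (s(l, b) ∈ T.edges ∧ s(b, r) ∈ T.edges) := by
  obtain ⟨h1, h2, h3⟩ := h
  obtain ⟨z, hz, e1, e2⟩ := Triangulation.exists_apex (z := b) h1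
    (by simp only [sbtw_iff_pos a, pos_self] at *; omega)
  rcases lt_trichotomy (pos a z) (pos a b) with hzb | hzb | hzb
  · refine Or.inl ⟨z, ?_, e1, e2, ?_, h3⟩ <;>
    · simp only [sbtw_iff_pos a, pos_self] at *
      omega
  · rw [pos_inj] at hzb
    subst hzb
    exact Or.inr (Or.inr ⟨e1, e2⟩)
  · refine Or.inr (Or.inl ⟨z, ?_, by rwa [Sym2.eq_swap], e1, h2, ?_⟩) <;>
    · simp only [sbtw_iff_pos a, pos_self] at *
      omega

/-- The triangle in front of a crossed diagonal, seen from `a`, starts in `a` or comes from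
another crossed diagonal. -/
lemma IsRung.prev {l r : Fin (n + 3)} (h : IsRung T a b l r) :
    (∃ z, pos a z < pos a l ∧ IsRung T a b z r) ∨ (∃ z, pos a r < pos a z ∧ IsRung T a b l z) ∨
    (s(a, l) ∈ T.edges ∧ s(a, r) ∈ T.edges) := by
  obtain ⟨h1, h2, h3⟩ := h
  obtain ⟨z, hz, e1, e2⟩ := Triangulation.exists_apex (z := a) (by rwa [Sym2.eq_swap] at h1)
    (by simp only [sbtw_iff_pos a, pos_self] at *; omega)
  by_cases hza : z = a
  · subst hza
    exact Or.inr (Or.inr ⟨e2, by rwa [Sym2.eq_swap]⟩)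
  · have hz0 : pos a z ≠ pos a a := fun h => hza (pos_inj.1 h)
    rcases lt_or_ge (pos a z) (pos a l) with hzl | hzl
    · refine Or.inl ⟨z, hzl, by rwa [Sym2.eq_swap], ?_, h3⟩
      simp only [sbtw_iff_pos a, pos_self] at *
      omega
    · refine Or.inr (Or.inl ⟨z, ?_, by rwa [Sym2.eq_swap], h2, ?_⟩) <;>
      · simp only [sbtw_iff_pos a, pos_self] at *
        omega

/-- The crossed diagonals of `T` in the order in which the segment from `a` to `b` meets them:
the `k`-th one joins `left k` and `right k`, for `1 ≤ k ≤ d`, and the degenerate diagonals at `a`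
(`k = 0`) and `b` (`k = d + 1`) are added at the ends. Consecutive diagonals share one endpoint. -/
structure Strip (T : Triangulation n) (a b : Fin (n + 3)) where
  d : ℕ
  left : ℕ → Fin (n + 3)
  right : ℕ → Fin (n + 3)
  d_pos : 0 < d
  left_zero : left 0 = a
  right_zero : right 0 = a
  left_last : left (d + 1) = b
  right_last : right (d + 1) = b
  rung : ∀ i < d, IsRung T a b (left (i + 1)) (right (i + 1))
  surj : ∀ l r, IsRung T a b l r → ∃ i < d, left (i + 1) = l ∧ right (i + 1) = r
  start_left : s(a, left 1) ∈ T.edges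
  start_right : s(a, right 1) ∈ T.edges
  finish_left : s(left d, b) ∈ T.edges
  finish_right : s(right d, b) ∈ T.edges
  step : ∀ i, i + 1 < d →
    (right (i + 2) = right (i + 1) ∧ pos a (left (i + 1)) < pos a (left (i + 2)) ∧
      s(left (i + 1), left (i + 2)) ∈ T.edges) ∨
    (left (i + 2) = left (i + 1) ∧ pos a (right (i + 2)) < pos a (right (i + 1)) ∧
      s(right (i + 1), right (i + 2)) ∈ T.edges)

lemma exists_isRung (hγ : IsDiagonal s(a, b)) (hγT : s(a, b) ∉ T.diagonals) :
    ∃ l r, IsRung T a b l r := by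
  by_contra! hno
  refine hγT (T.maximal _ hγ fun f hf hc => ?_)
  obtain ⟨l, r, -, h⟩ := mem_crossed_iff.1 (show f ∈ T.crossed a b from ⟨hf, hc⟩)
  exact hno l r h

theorem exists_strip (hγ : IsDiagonal s(a, b)) (hγT : s(a, b) ∉ T.diagonals) :
    Nonempty (Strip T a b) := by
  classical
  -- The number of vertices on the side of `a` increases along `γ`.
  let f : Fin (n + 3) × Fin (n + 3) → ℕ := fun p => pos a p.1 + (n + 3 - pos a p.2)
  have hbd : ∀ x, pos a x < n + 3 := fun x => (x - a).isLt
  have key : ∀ {l r l' r'}, IsRung T a b l r → IsRung T a b l' r' → f (l, r) ≤ f (l', r') →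
      pos a l ≤ pos a l' ∧ pos a r' ≤ pos a r := by
    intro l r l' r' h h' hle
    have h1 := h.nested h'
    have h2 := h'.nested h
    have := hbd l
    have := hbd l'
    have := hbd r
    have := hbd r'
    simp only [f] at hle
    rcases lt_trichotomy (pos a l) (pos a l') with h3 | h3 | h3
    · exact ⟨h3.le, h1 h3⟩
    · omega
    · have := h2 h3
      omega
  obtain ⟨p, hp1, hp2, hp3⟩ := exists_strictMono_enumeration
    (Finset.univ.filter fun p : Fin (n + 3) × Fin (n + 3) => IsRung T a b p.1 p.2) f (by
      rintro ⟨l, r⟩ h ⟨l', r'⟩ h' he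
      simp only [Finset.coe_filter, Finset.mem_univ, true_and, Set.mem_ofPred_eq] at h h'
      have h1 := key h h' he.le
      have h2 := key h' h he.ge
      rw [Prod.mk.injEq, ← pos_inj (o := a), ← pos_inj (o := a)]
      omega)
  set d := (Finset.univ.filter
    fun p : Fin (n + 3) × Fin (n + 3) => IsRung T a b p.1 p.2).card with hd
  simp only [Finset.mem_filter, Finset.mem_univ, true_and, Prod.forall] at hp1 hp3
  have hdpos : 0 < d := by
    obtain ⟨l, r, h⟩ := exists_isRung hγ hγT
    obtain ⟨k, hk, -⟩ := hp3 l r h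
    omega
  have hmono : ∀ i j, i ≤ j → j < d → f (p i) ≤ f (p j) := fun i j hij hj =>
    hij.lt_or_eq.elim (fun h => (hp2 i j h hj).le) (fun h => h ▸ le_rfl)
  have hstart : s(a, (p 0).1) ∈ T.edges ∧ s(a, (p 0).2) ∈ T.edges := by
    rcases (hp1 0 hdpos).prev with ⟨z, hz, h⟩ | ⟨z, hz, h⟩ | h
    · obtain ⟨k, hk, hpk⟩ := hp3 _ _ h
      have := hmono 0 k (Nat.zero_le _) hk
      rw [hpk] at this
      simp only [f] at this
      omega
    · obtain ⟨k, hk, hpk⟩ := hp3 _ _ h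
      have := hmono 0 k (Nat.zero_le _) hk
      rw [hpk] at this
      simp only [f] at this
      have := hbd z
      omega
    · exact h
  -- A crossed diagonal that comes after the `i`-th one is not met before the `(i + 1)`-st one.
  have hnext : ∀ i < d, ∀ l r, IsRung T a b l r → f (p i) < f (l, r) →
      i + 1 < d ∧ f (p (i + 1)) ≤ f (l, r) := by
    intro i hi l r h hlt
    obtain ⟨k, hk, hpk⟩ := hp3 l r h
    have hik : i < k := by
      by_contra! hki
      have := hmono k i hki hi
      rw [hpk] at this
      omega
    refine ⟨by omega, ?_⟩
    rw [← hpk]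
    exact hmono _ _ hik hk
  have hstep : ∀ i < d,
      (i + 1 < d ∧ (p (i + 1)).2 = (p i).2 ∧ pos a (p i).1 < pos a (p (i + 1)).1 ∧
        s((p i).1, (p (i + 1)).1) ∈ T.edges) ∨
      (i + 1 < d ∧ (p (i + 1)).1 = (p i).1 ∧ pos a (p (i + 1)).2 < pos a (p i).2 ∧
        s((p i).2, (p (i + 1)).2) ∈ T.edges) ∨
      (i + 1 = d ∧ s((p i).1, b) ∈ T.edges ∧ s(b, (p i).2) ∈ T.edges) := by
    intro i hi
    rcases (hp1 i hi).next with ⟨z, hz, e, h⟩ | ⟨z, hz, e, h⟩ | ⟨e1, e2⟩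
    · obtain ⟨hi1, hle⟩ := hnext i hi _ _ h (by simp only [f]; omega)
      have h1 := key (hp1 i hi) (hp1 (i + 1) hi1) (hp2 i (i + 1) (by omega) hi1).le
      have h2 := key (hp1 (i + 1) hi1) h hle
      have hlt := hp2 i (i + 1) (by omega) hi1
      have h3 := Triangulation.edges_not_interleave e (hp1 (i + 1) hi1).1
      have h4 := (hp1 i hi).2
      have h5 := (hp1 (i + 1) hi1).2
      have h6 := h.2
      have hr : (p (i + 1)).2 = (p i).2 := by
        rw [← pos_inj (o := a)]
        omega
      simp only [f, hr] at hlt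
      have hl : (p (i + 1)).1 = z := by
        rw [← pos_inj (o := a)]
        simp only [sbtw_iff_pos a, pos_self] at *
        omega
      exact Or.inl ⟨hi1, hr, by rwa [hl], by rwa [hl]⟩
    · obtain ⟨hi1, hle⟩ := hnext i hi _ _ h (by simp only [f]; have := hbd (p i).2; omega)
      have h1 := key (hp1 i hi) (hp1 (i + 1) hi1) (hp2 i (i + 1) (by omega) hi1).le
      have h2 := key (hp1 (i + 1) hi1) h hle
      have hlt := hp2 i (i + 1) (by omega) hi1
      have h3 := Triangulation.edges_not_interleave (x := z) (y := (p i).2)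
        (u := (p (i + 1)).2) (v := (p (i + 1)).1) (by rw [Sym2.eq_swap]; exact e)
        (by rw [Sym2.eq_swap]; exact (hp1 (i + 1) hi1).1)
      have h4 := (hp1 i hi).2
      have h5 := (hp1 (i + 1) hi1).2
      have h6 := h.2
      have hl : (p (i + 1)).1 = (p i).1 := by
        rw [← pos_inj (o := a)]
        omega
      simp only [f, hl] at hlt
      have hr : (p (i + 1)).2 = z := by
        rw [← pos_inj (o := a)]
        simp only [sbtw_iff_pos a, pos_self] at *
        omega
      exact Or.inr (Or.inl ⟨hi1, hl, by rwa [hr], by rwa [hr]⟩)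
    · refine Or.inr (Or.inr ⟨?_, e1, e2⟩)
      by_contra hne
      have hi1 : i + 1 < d := by omega
      have h1 := key (hp1 i hi) (hp1 (i + 1) hi1) (hp2 i (i + 1) (by omega) hi1).le
      have hlt := hp2 i (i + 1) (by omega) hi1
      have h3 := Triangulation.edges_not_interleave e1 (hp1 (i + 1) hi1).1
      have h3' := Triangulation.edges_not_interleave (u := (p (i + 1)).2) (v := (p (i + 1)).1) e2
        (by rw [Sym2.eq_swap]; exact (hp1 (i + 1) hi1).1)
      have h4 := (hp1 i hi).2
      have h5 := (hp1 (i + 1) hi1).2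
      simp only [f] at hlt
      simp only [sbtw_iff_pos a, pos_self] at *
      omega
  have hd1 : d - 1 + 1 = d := by omega
  have hfin : s((p (d - 1)).1, b) ∈ T.edges ∧ s((p (d - 1)).2, b) ∈ T.edges := by
    rcases hstep (d - 1) (by omega) with ⟨h, -⟩ | ⟨h, -⟩ | ⟨-, h, h'⟩
    · omega
    · omega
    · exact ⟨h, by rwa [Sym2.eq_swap]⟩
  refine ⟨⟨d, fun k => if k = 0 then a else if k = d + 1 then b else (p (k - 1)).1,
    fun k => if k = 0 then a else if k = d + 1 then b else (p (k - 1)).2, hdpos, by simp, by simp,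
    by simp, by simp, ?_, ?_, ?_, ?_, ?_, ?_, ?_⟩⟩
  · intro i hi
    simpa [hi.ne] using hp1 i hi
  · intro l r h
    obtain ⟨i, hi, hpi⟩ := hp3 l r h
    exact ⟨i, hi, by simp [hi.ne, hpi]⟩
  · simpa [hdpos.ne'] using hstart.1
  · simpa [hdpos.ne'] using hstart.2
  · simpa [hdpos.ne'] using hfin.1
  · simpa [hdpos.ne'] using hfin.2
  · intro i hi
    have h1 : i ≠ d := by omega
    have h2 : i + 2 ≠ d + 1 := by omega
    rcases hstep i (by omega) with h | h | h
    · left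
      simpa [h1, h2] using h.2
    · right
      simpa [h1, h2] using h.2
    · omega

end SnakePolytope

namespace SnakePolytope
namespace Strip

open Triangulation

variable {n : ℕ} {T : Triangulation n} {a b : Fin (n + 3)} (S : Strip T a b)

/-- The `k`-th crossed diagonal of the strip; degenerate for `k = 0` and `k = d + 1`. -/
def side (k : ℕ) : Sym2 (Fin (n + 3)) := s(S.left k, S.right k)

/-- The vertex in which the triangle behind the `(i + 1)`-st diagonal leaves that diagonal. -/
def new (i : ℕ) : Fin (n + 3) :=
  if S.right (i + 2) = S.right (i + 1) then S.left (i + 2) else S.right (i + 2)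

/-- The vertex of the triangle in front of the `(i + 1)`-st diagonal that is not on it. -/
def old (i : ℕ) : Fin (n + 3) :=
  if S.right i = S.right (i + 1) then S.left i else S.right i

lemma mem_side {x : Fin (n + 3)} {k : ℕ} : x ∈ S.side k ↔ x = S.left k ∨ x = S.right k :=
  Sym2.mem_iff

lemma left_mem (k : ℕ) : S.left k ∈ S.side k := S.mem_side.2 (Or.inl rfl)

lemma right_mem (k : ℕ) : S.right k ∈ S.side k := S.mem_side.2 (Or.inr rfl)

lemma mem_side_zero {x : Fin (n + 3)} : x ∈ S.side 0 ↔ x = a := by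
  simp [mem_side, S.left_zero, S.right_zero]

lemma mem_side_last {x : Fin (n + 3)} : x ∈ S.side (S.d + 1) ↔ x = b := by
  simp [mem_side, S.left_last, S.right_last]

lemma rung_pos {i : ℕ} (hi : i < S.d) : 0 < pos a (S.left (i + 1)) ∧
    pos a (S.left (i + 1)) < pos a b ∧ pos a b < pos a (S.right (i + 1)) := by
  obtain ⟨-, h1, h2⟩ := S.rung i hi
  simp only [sbtw_iff_pos a, pos_self] at *
  omega

lemma a_ne_b (S : Strip T a b) : a ≠ b := by
  have := S.rung_pos S.d_pos
  rintro rfl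
  simp at this

lemma left_ne_right {i : ℕ} (hi : i < S.d) : S.left (i + 1) ≠ S.right (i + 1) := by
  have := S.rung_pos hi
  rw [Ne, ← pos_inj (o := a)]
  omega

lemma side_mem_edges {i : ℕ} (hi : i < S.d) : S.side (i + 1) ∈ T.edges := (S.rung i hi).1

lemma mem_crossed {τ : Sym2 (Fin (n + 3))} :
    τ ∈ T.crossed a b ↔ ∃ i < S.d, τ = S.side (i + 1) := by
  rw [mem_crossed_iff]
  constructor
  · rintro ⟨l, r, rfl, h⟩
    obtain ⟨i, hi, rfl, rfl⟩ := S.surj l r h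
    exact ⟨i, hi, rfl⟩
  · rintro ⟨i, hi, rfl⟩
    exact ⟨_, _, rfl, S.rung i hi⟩

lemma new_spec {i : ℕ} (hi : i < S.d) :
    pos a (S.left (i + 1)) < pos a (S.new i) ∧ pos a (S.new i) < pos a (S.right (i + 1)) ∧
    s(S.left (i + 1), S.new i) ∈ T.edges ∧ s(S.right (i + 1), S.new i) ∈ T.edges ∧
    ((i + 1 < S.d ∧ S.left (i + 2) = S.new i ∧ S.right (i + 2) = S.right (i + 1)) ∨
      (i + 1 < S.d ∧ S.left (i + 2) = S.left (i + 1) ∧ S.right (i + 2) = S.new i) ∨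
      (i + 1 = S.d ∧ S.left (i + 2) = S.new i ∧ S.right (i + 2) = S.new i ∧ S.new i = b)) := by
  rcases lt_or_eq_of_le (Nat.succ_le_of_lt hi) with hi1 | hi1
  · rw [Nat.succ_eq_add_one] at hi1
    have hp := S.rung_pos hi
    have hp' := S.rung_pos hi1
    have he := (S.rung (i + 1) hi1).1
    rcases S.step i hi1 with ⟨h1, h2, h3⟩ | ⟨h1, h2, h3⟩
    · have hn : S.new i = S.left (i + 2) := by simp [new, h1]
      rw [hn]
      refine ⟨h2, ?_, h3, ?_, Or.inl ⟨hi1, rfl, h1⟩⟩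
      · rw [add_assoc, one_add_one_eq_two] at hp'
        omega
      · rw [Sym2.eq_swap, ← h1]
        exact he
    · have hne : S.right (i + 2) ≠ S.right (i + 1) := by
        rw [Ne, ← pos_inj (o := a)]
        omega
      have hn : S.new i = S.right (i + 2) := by simp [new, hne]
      rw [hn]
      refine ⟨?_, h2, ?_, h3, Or.inr (Or.inl ⟨hi1, h1, rfl⟩)⟩
      · rw [add_assoc, one_add_one_eq_two] at hp'
        omega
      · rw [← h1]
        exact he
  · rw [Nat.succ_eq_add_one] at hi1
    have hp := S.rung_pos hi
    have hl : S.left (i + 2) = b := (congrArg S.left (congrArg (· + 1) hi1)).trans S.left_last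
    have hr : S.right (i + 2) = b := (congrArg S.right (congrArg (· + 1) hi1)).trans S.right_last
    have hn : S.new i = b := by simp [new, hl, hr]
    rw [hn, hl, hr, hi1]
    rw [hi1] at hp
    exact ⟨hp.2.1, hp.2.2, S.finish_left, S.finish_right, by simp⟩

lemma new_mem_side {i : ℕ} (hi : i < S.d) : S.new i ∈ S.side (i + 2) := by
  rw [mem_side]
  obtain ⟨-, -, -, -, h⟩ := S.new_spec hi
  rcases h with h | h | h <;> simp [h]

lemma mem_side_succ {i : ℕ} (hi : i < S.d) {x : Fin (n + 3)} (hx : x ∈ S.side (i + 2)) :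
    x = S.new i ∨ x ∈ S.side (i + 1) := by
  rw [mem_side] at hx ⊢
  obtain ⟨-, -, -, -, h⟩ := S.new_spec hi
  rcases h with ⟨-, h1, h2⟩ | ⟨-, h1, h2⟩ | ⟨-, h1, h2, -⟩ <;> rw [h1, h2] at hx <;> tauto

lemma old_zero : S.old 0 = a := by
  have := S.rung_pos S.d_pos
  have hne : S.right 0 ≠ S.right (0 + 1) := by
    rw [Ne, ← pos_inj (o := a), S.right_zero, pos_self]
    omega
  rw [old, if_neg hne, S.right_zero]

lemma old_succ {i : ℕ} (hi : i + 1 < S.d) :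
    (S.old (i + 1) = S.left (i + 1) ∧ S.left (i + 2) = S.new i ∧
      S.right (i + 2) = S.right (i + 1)) ∨
    (S.old (i + 1) = S.right (i + 1) ∧ S.left (i + 2) = S.left (i + 1) ∧
      S.right (i + 2) = S.new i) := by
  obtain ⟨h3, h4, -, -, h⟩ := S.new_spec (i := i) (by omega)
  rcases h with ⟨-, h1, h2⟩ | ⟨-, h1, h2⟩ | ⟨h1, -⟩
  · exact Or.inl ⟨by simp [old, h2], h1, h2⟩
  · have hne : S.right (i + 1) ≠ S.right (i + 2) := by
      rw [h2, Ne, ← pos_inj (o := a)]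
      omega
    exact Or.inr ⟨by simp [old, hne], h1, h2⟩
  · omega

lemma old_spec {i : ℕ} (hi : i < S.d) :
    (pos a (S.old i) < pos a (S.left (i + 1)) ∨ pos a (S.right (i + 1)) < pos a (S.old i)) ∧
    s(S.old i, S.left (i + 1)) ∈ T.edges ∧ s(S.old i, S.right (i + 1)) ∈ T.edges ∧
    S.old i ∈ S.side i ∧ (∀ x ∈ S.side i, x = S.old i ∨ x ∈ S.side (i + 1)) := by
  rcases i with _ | i
  · rw [old_zero]
    refine ⟨Or.inl ?_, S.start_left, S.start_right, S.mem_side_zero.2 rfl,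
      fun x hx => Or.inl (S.mem_side_zero.1 hx)⟩
    rw [pos_self]
    exact (S.rung_pos hi).1
  · obtain ⟨h1, h2, h3, h4, -⟩ := S.new_spec (i := i) (by omega)
    have he := S.side_mem_edges (i := i) (by omega)
    have he' : s(S.right (i + 1), S.left (i + 1)) ∈ T.edges := by
      rw [Sym2.eq_swap]
      exact he
    rw [add_assoc, one_add_one_eq_two]
    rcases S.old_succ hi with ⟨h5, h6, h7⟩ | ⟨h5, h6, h7⟩
    · rw [h5, h6, h7]
      refine ⟨Or.inl h1, h3, he, S.left_mem _, fun x hx => ?_⟩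
      rw [mem_side] at hx ⊢
      rw [h7]
      tauto
    · rw [h5, h6, h7]
      refine ⟨Or.inr h2, he', h4, S.right_mem _, fun x hx => ?_⟩
      rw [mem_side] at hx ⊢
      rw [h6]
      tauto

lemma new_notMem_side {i : ℕ} (hi : i < S.d) : S.new i ∉ S.side (i + 1) := by
  obtain ⟨h1, h2, -⟩ := S.new_spec hi
  rw [mem_side, ← pos_inj (o := a), ← pos_inj (o := a)]
  omega

lemma old_notMem_side {i : ℕ} (hi : i < S.d) : S.old i ∉ S.side (i + 1) := by
  obtain ⟨h1, -⟩ := S.old_spec hi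
  have := S.rung_pos hi
  rw [mem_side, ← pos_inj (o := a), ← pos_inj (o := a)]
  omega

lemma edge_new {i : ℕ} (hi : i < S.d) {x : Fin (n + 3)} (hx : x ∈ S.side (i + 1)) :
    s(x, S.new i) ∈ T.edges := by
  obtain ⟨-, -, h1, h2, -⟩ := S.new_spec hi
  rcases S.mem_side.1 hx with rfl | rfl <;> assumption

lemma edge_old {i : ℕ} (hi : i < S.d) {x : Fin (n + 3)} (hx : x ∈ S.side (i + 1)) :
    s(S.old i, x) ∈ T.edges := by
  obtain ⟨-, h1, h2, -⟩ := S.old_spec hi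
  rcases S.mem_side.1 hx with rfl | rfl <;> assumption

/-! ### The triangles of the strip as a growing two-tree -/

/-- The vertices of the first `m + 1` triangles of the strip. -/
def verts : ℕ → Finset (Fin (n + 3))
  | 0 => {a, S.left 1, S.right 1}
  | m + 1 => insert (S.new m) (verts m)

/-- The sides of the first `m + 1` triangles of the strip. -/
def sides : ℕ → Finset (Sym2 (Fin (n + 3)))
  | 0 => {s(a, S.left 1), s(a, S.right 1), S.side 1}
  | m + 1 => insert s(S.left (m + 1), S.new m) (insert s(S.right (m + 1), S.new m) (sides m))

lemma mem_verts {m : ℕ} (hm : m ≤ S.d) {x : Fin (n + 3)} :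
    x ∈ S.verts m ↔ ∃ j ≤ m + 1, x ∈ S.side j := by
  induction m with
  | zero =>
    simp only [verts, Finset.mem_insert, Finset.mem_singleton]
    constructor
    · rintro (rfl | rfl | rfl)
      · exact ⟨0, by omega, S.mem_side_zero.2 rfl⟩
      · exact ⟨1, by omega, S.left_mem 1⟩
      · exact ⟨1, by omega, S.right_mem 1⟩
    · rintro ⟨j, hj, h⟩
      interval_cases j
      exacts [Or.inl (S.mem_side_zero.1 h), Or.inr (S.mem_side.1 h)]
  | succ m ih =>
    rw [verts, Finset.mem_insert, ih (by omega)]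
    constructor
    · rintro (rfl | ⟨j, hj, h⟩)
      · exact ⟨m + 2, by omega, S.new_mem_side hm⟩
      · exact ⟨j, by omega, h⟩
    · rintro ⟨j, hj, h⟩
      rcases Nat.lt_or_ge j (m + 2) with h1 | h1
      · exact Or.inr ⟨j, by omega, h⟩
      · obtain rfl : j = m + 2 := by omega
        rcases S.mem_side_succ hm h with h2 | h2
        · exact Or.inl h2
        · exact Or.inr ⟨m + 1, by omega, h2⟩

/-- The vertices of the first triangles lie on the side of the last of their diagonals that
contains `a`. -/
lemma pos_of_mem_verts {m : ℕ} (hm : m < S.d) {x : Fin (n + 3)} (hx : x ∈ S.verts m) :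
    pos a x ≤ pos a (S.left (m + 1)) ∨ pos a (S.right (m + 1)) ≤ pos a x := by
  induction m with
  | zero =>
    simp only [verts, Finset.mem_insert, Finset.mem_singleton] at hx
    rcases hx with rfl | rfl | rfl <;> simp
  | succ m ih =>
    obtain ⟨h1, h2, -⟩ := S.new_spec (i := m) (by omega)
    have h := S.old_succ hm
    have e : m + 1 + 1 = m + 2 := rfl
    rw [verts, Finset.mem_insert] at hx
    rcases hx with rfl | hx
    · rcases h with ⟨-, h3, h4⟩ | ⟨-, h3, h4⟩ <;> rw [e, h3, h4] <;> simp
    · have := ih (by omega) hx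
      rcases h with ⟨-, h3, h4⟩ | ⟨-, h3, h4⟩ <;> rw [e, h3, h4] <;> omega

lemma new_notMem_verts {m : ℕ} (hm : m < S.d) : S.new m ∉ S.verts m := by
  intro h
  have := S.pos_of_mem_verts hm h
  obtain ⟨h1, h2, -⟩ := S.new_spec hm
  omega

lemma side_mem_verts {m j : ℕ} (hm : m ≤ S.d) (hj : j ≤ m + 1) {x : Fin (n + 3)}
    (hx : x ∈ S.side j) : x ∈ S.verts m := (S.mem_verts hm).2 ⟨j, hj, hx⟩

lemma new_notMem_side_of_le {m j : ℕ} (hm : m < S.d) (hj : j ≤ m + 1) : S.new m ∉ S.side j :=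
  fun h => S.new_notMem_verts hm (S.side_mem_verts hm.le hj h)

lemma card_verts {m : ℕ} (hm : m ≤ S.d) : (S.verts m).card = m + 3 := by
  induction m with
  | zero =>
    have h1 := ne_of_mem_edges S.start_left
    have h2 := ne_of_mem_edges S.start_right
    have h3 := S.left_ne_right S.d_pos
    rw [verts, Finset.card_insert_of_notMem (by simp [h1, h2]),
      Finset.card_insert_of_notMem (by simpa using h3), Finset.card_singleton]
  | succ m ih =>
    rw [verts, Finset.card_insert_of_notMem (S.new_notMem_verts hm), ih (by omega)]

/-- An edge of `T` between vertices of the first triangles is one of their sides: an edge from the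
vertex added last to a vertex not on the last diagonal would cross that diagonal. -/
lemma mem_sides {m : ℕ} (hm : m ≤ S.d) {e : Sym2 (Fin (n + 3))} :
    e ∈ S.sides m ↔ e ∈ T.edges ∧ ∀ x ∈ e, x ∈ S.verts m := by
  induction m generalizing e with
  | zero =>
    constructor
    · simp only [sides, verts, Finset.mem_insert, Finset.mem_singleton]
      have := S.start_left
      have := S.start_right
      have := S.side_mem_edges S.d_pos
      rintro (rfl | rfl | rfl)
      · simpa
      · simpa
      · exact ⟨this, fun x hx => Or.inr (S.mem_side.1 hx)⟩
    · rintro ⟨he, h⟩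
      induction e with | _ u v
      have huv := ne_of_mem_edges he
      simp only [Sym2.mem_iff, forall_eq_or_imp, forall_eq, verts, Finset.mem_insert,
        Finset.mem_singleton] at h
      obtain ⟨hu, hv⟩ := h
      rcases hu with rfl | rfl | rfl <;> rcases hv with rfl | rfl | rfl <;>
        simp_all [sides, side, Sym2.eq_swap]
  | succ m ih =>
    have ih := @ih (by omega)
    have hL := S.left_mem (m + 1)
    have hR := S.right_mem (m + 1)
    constructor
    · simp only [sides, verts, Finset.mem_insert]
      have hm' : m ≤ S.d := by omega
      rintro (rfl | rfl | he)
      · refine ⟨S.edge_new hm hL, fun x hx => ?_⟩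
        rcases Sym2.mem_iff.1 hx with rfl | rfl
        · exact Or.inr (S.side_mem_verts hm' le_rfl hL)
        · exact Or.inl rfl
      · refine ⟨S.edge_new hm hR, fun x hx => ?_⟩
        rcases Sym2.mem_iff.1 hx with rfl | rfl
        · exact Or.inr (S.side_mem_verts hm' le_rfl hR)
        · exact Or.inl rfl
      · exact ⟨(ih.1 he).1, fun x hx => Or.inr ((ih.1 he).2 x hx)⟩
    · rintro ⟨he, h⟩
      have key : ∀ u, u ∈ S.verts m → s(u, S.new m) ∈ T.edges → u ∈ S.side (m + 1) := by
        intro u hu hue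
        obtain ⟨h1, h2, -⟩ := S.new_spec hm
        have h3 := S.pos_of_mem_verts hm hu
        have h4 := edges_not_interleave (S.rung m hm).1 (u := S.new m) (v := u)
          (by rwa [Sym2.eq_swap])
        rw [mem_side, ← pos_inj (o := a), ← pos_inj (o := a)]
        simp only [sbtw_iff_pos a] at h4
        omega
      induction e with | _ u v
      have huv := ne_of_mem_edges he
      simp only [Sym2.mem_iff, forall_eq_or_imp, forall_eq, verts, Finset.mem_insert] at h
      simp only [sides, Finset.mem_insert]
      obtain ⟨hu, hv⟩ := h
      rcases hu with rfl | hu <;> rcases hv with rfl | hv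
      · exact absurd rfl huv
      · rcases S.mem_side.1 (key v hv (by rwa [Sym2.eq_swap])) with rfl | rfl <;>
          simp [Sym2.eq_swap]
      · rcases S.mem_side.1 (key u hu he) with rfl | rfl <;> simp
      · refine Or.inr (Or.inr (ih.2 ⟨he, fun x hx => ?_⟩))
        rcases Sym2.mem_iff.1 hx with rfl | rfl <;> assumption

lemma card_sides {m : ℕ} (hm : m ≤ S.d) : (S.sides m).card = 2 * m + 3 := by
  induction m with
  | zero =>
    have h1 := ne_of_mem_edges S.start_left
    have h2 := ne_of_mem_edges S.start_right
    have h3 := S.left_ne_right S.d_pos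
    rw [sides, side, Finset.card_insert_of_notMem (by simp_all),
      Finset.card_insert_of_notMem (by simp_all), Finset.card_singleton]
  | succ m ih =>
    have h : ∀ x, s(x, S.new m) ∉ S.sides m := fun x hx =>
      S.new_notMem_verts hm (((S.mem_sides (by omega)).1 hx).2 _ (Sym2.mem_mk_right _ _))
    have hne := S.left_ne_right hm
    rw [sides, Finset.card_insert_of_notMem, Finset.card_insert_of_notMem (h _), ih (by omega)]
    · ring
    · rw [Finset.mem_insert]
      refine not_or.2 ⟨fun he => ?_, h _⟩
      rw [Sym2.eq_iff] at he
      have := ne_of_mem_edges (S.edge_new hm (S.left_mem (m + 1)))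
      tauto

lemma mem_subVertices {w : Fin (n + 3)} : w ∈ T.subVertices a b ↔ w ∈ S.verts S.d := by
  rw [S.mem_verts le_rfl]
  constructor
  · rintro ⟨e, rfl | he, hw⟩
    · rcases Sym2.mem_iff.1 hw with rfl | rfl
      · exact ⟨0, by omega, S.mem_side_zero.2 rfl⟩
      · exact ⟨S.d + 1, le_rfl, S.mem_side_last.2 rfl⟩
    · obtain ⟨i, hi, rfl⟩ := S.mem_crossed.1 he
      exact ⟨i + 1, by omega, hw⟩
  · rintro ⟨j, hj, hw⟩
    rcases j with _ | j
    · exact ⟨s(a, b), Or.inl rfl, by simp [S.mem_side_zero.1 hw]⟩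
    · rcases Nat.lt_or_ge j S.d with h | h
      · exact ⟨_, Or.inr (S.mem_crossed.2 ⟨j, h, rfl⟩), hw⟩
      · obtain rfl : j = S.d := by omega
        exact ⟨s(a, b), Or.inl rfl, by simp [S.mem_side_last.1 hw]⟩

lemma mem_subEdges {e : T.Edge} : e ∈ T.subEdges a b ↔ e.1 ∈ S.sides S.d := by
  rw [S.mem_sides le_rfl]
  simp only [Triangulation.subEdges, Set.mem_ofPred_eq, S.mem_subVertices]
  exact ⟨fun h => ⟨e.2, h⟩, fun h => h.2⟩

/-- The dual form of the surjectivity of the unsigned incidence map of the two-tree: a function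
on the vertices whose two values on each edge are opposite vanishes on the first triangle, hence
everywhere. -/
lemma eq_zero_of_add_eq_zero (y : Fin (n + 3) → ℝ) {m : ℕ} (hm : m ≤ S.d)
    (h : ∀ u v, s(u, v) ∈ S.sides m → y u + y v = 0) : ∀ x ∈ S.verts m, y x = 0 := by
  induction m with
  | zero =>
    have h1 := h a (S.left 1) (by simp [sides])
    have h2 := h a (S.right 1) (by simp [sides])
    have h3 := h (S.left 1) (S.right 1) (by simp [sides, side])
    simp only [verts, Finset.mem_insert, Finset.mem_singleton]
    rintro x (rfl | rfl | rfl) <;> linarith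
  | succ m ih =>
    have ih := ih (by omega) fun u v huv => h u v (by simp [sides, huv])
    intro x hx
    rw [verts, Finset.mem_insert] at hx
    rcases hx with rfl | hx
    · have h1 := h (S.left (m + 1)) (S.new m) (by simp [sides])
      rw [ih _ (S.side_mem_verts (by omega) le_rfl (S.left_mem _))] at h1
      linarith
    · exact ih x hx

/-- A weight on the sides of the strip whose alternating sum around every quadrilateral `Q_τ`
vanishes is the sum of two vertex weights: extend the vertex weight along the two-tree. -/
lemma exists_vertex_weight (φ : Sym2 (Fin (n + 3)) → ℝ)
    (h : ∀ i < S.d, φ s(S.old i, S.left (i + 1)) + φ s(S.right (i + 1), S.new i) =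
      φ s(S.old i, S.right (i + 1)) + φ s(S.left (i + 1), S.new i)) {m : ℕ} (hm : m ≤ S.d) :
    ∃ y : Fin (n + 3) → ℝ, ∀ u v, s(u, v) ∈ S.sides m → φ s(u, v) = y u + y v := by
  classical
  -- Stated for unordered pairs, so that each side has to be treated in one order only.
  suffices H : ∃ y : Fin (n + 3) → ℝ, ∀ e ∈ S.sides m,
      φ e = Sym2.lift ⟨fun u v => y u + y v, fun u v => add_comm _ _⟩ e by
    obtain ⟨y, hy⟩ := H
    exact ⟨y, fun u v huv => hy _ huv⟩
  induction m with
  | zero =>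
    have h1 := ne_of_mem_edges S.start_left
    have h2 := ne_of_mem_edges S.start_right
    have h3 := S.left_ne_right S.d_pos
    rw [zero_add] at h3
    refine ⟨fun x =>
      if x = a then (φ s(a, S.left 1) + φ s(a, S.right 1) - φ (S.side 1)) / 2
      else if x = S.left 1 then (φ s(a, S.left 1) + φ (S.side 1) - φ s(a, S.right 1)) / 2
      else (φ s(a, S.right 1) + φ (S.side 1) - φ s(a, S.left 1)) / 2, ?_⟩
    intro e he
    simp only [sides, Finset.mem_insert, Finset.mem_singleton] at he
    rcases he with rfl | rfl | rfl
    · simp [h1.symm]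
      ring
    · simp [h2.symm, h3.symm]
      ring
    · simp [side, h1.symm, h2.symm, h3.symm]
      ring
  | succ m ih =>
    obtain ⟨y, hy⟩ := ih (by omega)
    have hm' : m ≤ S.d := by omega
    have hL := S.left_mem (m + 1)
    have hR := S.right_mem (m + 1)
    have hnew : ∀ x, x ∈ S.verts m → x ≠ S.new m :=
      fun x hx hxn => S.new_notMem_verts hm (hxn ▸ hx)
    have hLv := S.side_mem_verts hm' le_rfl hL
    have hRv := S.side_mem_verts hm' le_rfl hR
    have hold : S.old m ∈ S.verts m :=
      S.side_mem_verts hm' (Nat.le_succ m) (S.old_spec hm).2.2.2.1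
    have h1 := hy s(S.old m, S.left (m + 1)) ((S.mem_sides hm').2 ⟨S.edge_old hm hL, by
      simp [hold, hLv]⟩)
    have h2 := hy s(S.old m, S.right (m + 1)) ((S.mem_sides hm').2 ⟨S.edge_old hm hR, by
      simp [hold, hRv]⟩)
    have h3 := h m hm
    simp only [Sym2.lift_mk] at h1 h2
    refine ⟨Function.update y (S.new m) (φ s(S.left (m + 1), S.new m) - y (S.left (m + 1))), ?_⟩
    intro e he
    simp only [sides, Finset.mem_insert] at he
    rcases he with rfl | rfl | he
    · simp [Function.update_of_ne (hnew _ hLv)]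
    · simp [Function.update_of_ne (hnew _ hRv)]
      linarith
    · have hv := ((S.mem_sides hm').1 he).2
      rw [hy e he]
      induction e with | _ u v
      simp [Function.update_of_ne (hnew u (hv u (by simp))),
        Function.update_of_ne (hnew v (hv v (by simp)))]

end Strip
end SnakePolytope

namespace SnakePolytope

/-! ### The number of edges of a triangulation -/

namespace Triangulation

variable {n : ℕ} {T : Triangulation n}

lemma sbtw_of_lt {i j m : Fin (n + 3)} (hij : i < j) : sbtw i m j ↔ i < m ∧ m < j := by
  rw [sbtw_iff_val]
  simp only [Fin.lt_def] at *
  omega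

/-- An edge `ij` cuts off a triangulated polygon with `j - i + 1` vertices. -/
lemma card_edges_between (k : ℕ) : ∀ i j : Fin (n + 3), i < j → j.val - i.val = k →
    s(i, j) ∈ T.edges →
    (T.edges.filter fun e => ∀ x ∈ e, i ≤ x ∧ x ≤ j).card + 1 = 2 * k := by
  induction k using Nat.strong_induction_on with
  | _ k ih =>
    intro i j hij hk he
    by_cases hm : ∃ m, i < m ∧ m < j
    · obtain ⟨m, hm⟩ := hm
      obtain ⟨m, hm1, e1, e2⟩ := exists_apex he ((sbtw_of_lt hij).2 hm)
      rw [sbtw_of_lt hij] at hm1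
      obtain ⟨him, hmj⟩ := hm1
      have h1 := ih (m.val - i.val) (by simp only [Fin.lt_def] at *; omega) i m him rfl e1
      have h2 := ih (j.val - m.val) (by simp only [Fin.lt_def] at *; omega) m j hmj rfl e2
      have hsplit : (T.edges.filter fun e => ∀ x ∈ e, i ≤ x ∧ x ≤ j) =
          insert s(i, j) ((T.edges.filter fun e => ∀ x ∈ e, i ≤ x ∧ x ≤ m) ∪
            (T.edges.filter fun e => ∀ x ∈ e, m ≤ x ∧ x ≤ j)) := by
        ext e
        induction e with | _ u v
        simp only [Finset.mem_filter, Sym2.mem_iff, forall_eq_or_imp, forall_eq, Finset.mem_insert,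
          Finset.mem_union, Sym2.eq_iff]
        constructor
        · rintro ⟨h, hu, hv⟩
          have c1 := edges_not_interleave e1 h
          have c2 := edges_not_interleave e1 (u := v) (v := u) (by rwa [Sym2.eq_swap])
          have c3 := edges_not_interleave e2 h
          have c4 := edges_not_interleave e2 (u := v) (v := u) (by rwa [Sym2.eq_swap])
          simp only [h, true_and, sbtw_iff_val, Fin.lt_def, Fin.le_def, Fin.ext_iff] at *
          omega
        · rintro ((⟨rfl, rfl⟩ | ⟨rfl, rfl⟩) | ⟨h, h1, h2⟩ | ⟨h, h1, h2⟩)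
          · simp [he, hij.le]
          · rw [Sym2.eq_swap]
            simp [he, hij.le]
          · exact ⟨h, ⟨h1.1, h1.2.trans hmj.le⟩, h2.1, h2.2.trans hmj.le⟩
          · exact ⟨h, ⟨him.le.trans h1.1, h1.2⟩, him.le.trans h2.1, h2.2⟩
      rw [hsplit, Finset.card_insert_of_notMem, Finset.card_union_of_disjoint]
      · simp only [Fin.lt_def] at *
        omega
      · rw [Finset.disjoint_left]
        intro e h1 h2
        induction e with | _ u v
        simp only [Finset.mem_filter, Sym2.mem_iff, forall_eq_or_imp, forall_eq] at h1 h2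
        refine ne_of_mem_edges h1.1 ?_
        rw [le_antisymm h1.2.1.2 h2.2.1.1, le_antisymm h1.2.2.2 h2.2.2.1]
      · simp [hij.le, him, hmj]
    · have hji : j.val = i.val + 1 := by
        by_contra hne
        have := j.isLt
        exact hm ⟨⟨i.val + 1, by omega⟩, by simp only [Fin.lt_def] at *; omega⟩
      have hone : (T.edges.filter fun e => ∀ x ∈ e, i ≤ x ∧ x ≤ j) = {s(i, j)} := by
        ext e
        induction e with | _ u v
        simp only [Finset.mem_filter, Sym2.mem_iff, forall_eq_or_imp, forall_eq,
          Finset.mem_singleton, Sym2.eq_iff]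
        constructor
        · rintro ⟨h, hu, hv⟩
          have := ne_of_mem_edges h
          simp only [Fin.le_def, Fin.ext_iff, Ne] at *
          omega
        · rintro (⟨rfl, rfl⟩ | ⟨rfl, rfl⟩)
          · simp [he, hij.le]
          · rw [Sym2.eq_swap]
            simp [he, hij.le]
      rw [hone, Finset.card_singleton]
      omega

theorem card_edges (T : Triangulation n) : T.edges.card = 2 * n + 3 := by
  have he : s((0 : Fin (n + 3)), Fin.last (n + 2)) ∈ T.edges := by
    have := boundary_mem_edges (T := T) (Fin.last (n + 2))
    rwa [Fin.last_add_one, Sym2.eq_swap] at this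
  have h := card_edges_between (n + 2) 0 (Fin.last (n + 2)) (by simp [Fin.lt_def]) (by simp) he
  rw [Finset.filter_true_of_mem fun e _ x _ => ⟨Fin.zero_le x, Fin.le_last x⟩] at h
  omega

end Triangulation

/-! ### Systems of linear equations -/

namespace LinearSystem

variable {W : Type} [AddCommGroup W] [Module ℝ W] {L : LinearSystem W}

theorem Independent.irredundant [Finite L.Index] (h : L.Independent) (hs : L.solutions.Nonempty) :
    L.Irredundant := by
  intro i hi
  obtain ⟨x₀, hx₀⟩ := hs
  refine linearIndependent_iff_notMem_span.1 h i ?_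
  have himg : L.form '' (Set.univ \ {i}) = Set.range fun j : {j // j ≠ i} => L.form j := by
    ext f
    simp
  rw [himg]
  refine mem_span_of_iInf_ker_le_ker fun z hz => ?_
  simp only [Submodule.mem_iInf, LinearMap.mem_ker, Subtype.forall] at hz ⊢
  have hmem : x₀ + z ∈ L.solutions := by
    rw [← hi]
    intro j hj
    rw [map_add, hz j hj, add_zero, hx₀ j]
  have := hmem i
  rw [map_add, hx₀ i] at this
  linarith

theorem affineSpan_subset_solutions {X : Set W} (hX : X ⊆ L.solutions) :
    (affineSpan ℝ X : Set W) ⊆ L.solutions := by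
  let A : AffineSubspace ℝ W :=
    { carrier := L.solutions
      smul_vsub_vadd_mem' := by
        intro c p q r hp hq hr i
        simp [hp i, hq i, hr i] }
  exact affineSpan_le.2 (show X ⊆ A from hX)

/-- A set of solutions spans the solution space if every functional that is constant on it
vanishes wherever all forms of the system vanish. -/
theorem solutions_subset_affineSpan {X : Set W} (hX : X ⊆ L.solutions) (hne : X.Nonempty)
    (h : ∀ f : Module.Dual ℝ W, (∀ x ∈ X, ∀ y ∈ X, f x = f y) →
      ∀ z, (∀ i, L.form i z = 0) → f z = 0) :
    L.solutions ⊆ (affineSpan ℝ X : Set W) := by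
  intro y hy
  obtain ⟨x₀, hx₀⟩ := hne
  have hmem : y - x₀ ∈ vectorSpan ℝ X := by
    by_contra hno
    obtain ⟨f, hf, hle⟩ := Submodule.exists_le_ker_of_notMem hno
    refine hf (h f (fun x hx x' hx' => ?_) _ fun i => ?_)
    · have := hle (vsub_mem_vectorSpan ℝ hx hx')
      rw [LinearMap.mem_ker, vsub_eq_sub, map_sub] at this
      linarith
    · rw [map_sub, hy i, hX hx₀ i, sub_self]
  have := AffineSubspace.vadd_mem_of_mem_direction
    (by rwa [direction_affineSpan]) (mem_affineSpan ℝ hx₀)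
  simpa using this

/-- Two systems with the same equations, up to renaming the index set. -/
theorem Independent.of_equiv {L' : LinearSystem W} (h : L.Independent) (e : L'.Index ≃ L.Index)
    (he : ∀ i, L'.form i = L.form (e i)) : L'.Independent := by
  have : L'.form = L.form ∘ e := funext he
  rw [Independent, this]
  exact h.comp _ e.injective

end LinearSystem

/-! ### The equations of the triangulation -/

namespace Strip

open Triangulation

variable {n : ℕ} {T : Triangulation n} {a b : Fin (n + 3)} (S : Strip T a b)

lemma sumForm_apply (A : Set T.Edge) (x : T.Edge → ℝ) :
    T.sumForm A x = open Classical in ∑ e : T.Edge, if e ∈ A then x e else 0 := by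
  classical
  rw [sumForm, LinearMap.sum_apply, Finset.sum_filter]
  rfl

lemma sumForm_single (A : Set T.Edge) (e : T.Edge) :
    T.sumForm A (Pi.single e 1) = open Classical in if e ∈ A then 1 else 0 := by
  classical
  rw [sumForm_apply, Finset.sum_eq_single e]
  · simp
  · intro e' _ h
    simp [Pi.single_eq_of_ne h]
  · simp

theorem triangulationSystem_independent (S : Strip T a b) :
    (T.triangulationSystem a b).Independent := by
  classical
  change LinearIndependent ℝ (Sum.elim (fun e : {e : T.Edge // e ∉ T.subEdges a b} =>
      (LinearMap.proj e.1 : Module.Dual ℝ (T.Edge → ℝ)))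
    fun w : {w : Fin (n + 3) // w ∈ T.subVertices a b} =>
      T.sumForm {e | e ∈ T.subEdges a b ∧ w.1 ∈ e.1})
  rw [Fintype.linearIndependent_iff]
  intro g hg
  let y : Fin (n + 3) → ℝ := fun w =>
    if h : w ∈ T.subVertices a b then g (Sum.inr ⟨w, h⟩) else 0
  -- The coefficient of `x_e` in the relation.
  have hcoef : ∀ e : T.Edge, (if h : e ∈ T.subEdges a b then 0 else g (Sum.inl ⟨e, h⟩)) +
      (∑ w, if e ∈ T.subEdges a b ∧ w ∈ e.1 then y w else 0) = 0 := by
    intro e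
    have h := LinearMap.congr_fun hg (Pi.single e 1)
    simp only [Fintype.sum_sum_type, LinearMap.add_apply, LinearMap.sum_apply,
      LinearMap.smul_apply, Sum.elim_inl, Sum.elim_inr, sumForm_single, LinearMap.proj_apply,
      LinearMap.zero_apply, smul_eq_mul, Set.mem_ofPred_eq] at h
    refine Eq.trans ?_ h
    congr 1
    · split_ifs with he
      · refine (Finset.sum_eq_zero fun e' _ => ?_).symm
        have : e'.1 ≠ e := fun h => e'.2 (h ▸ he)
        simp [Pi.single_eq_of_ne this]
      · rw [Finset.sum_eq_single ⟨e, he⟩]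
        · simp
        · intro e' _ hne
          have : e'.1 ≠ e := fun h => hne (Subtype.ext h)
          simp [Pi.single_eq_of_ne this]
        · simp
    · rw [← Finset.sum_filter_of_ne (p := (· ∈ T.subVertices a b)),
        Finset.sum_subtype _ (p := (· ∈ T.subVertices a b)) (by simp)]
      · refine Finset.sum_congr rfl fun w _ => ?_
        simp [y, w.2]
      · intro w _ hw
        by_contra hno
        simp [y, hno] at hw
  have hy : ∀ x, y x = 0 := by
    intro x
    by_cases hx : x ∈ T.subVertices a b
    · refine S.eq_zero_of_add_eq_zero y le_rfl (fun u v huv => ?_) x (S.mem_subVertices.1 hx)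
      have he := ((S.mem_sides le_rfl).1 huv).1
      have hsub : (⟨s(u, v), he⟩ : T.Edge) ∈ T.subEdges a b := S.mem_subEdges.2 huv
      have h := hcoef ⟨s(u, v), he⟩
      simp only [hsub, dif_pos, true_and, zero_add, ← Finset.sum_filter] at h
      rw [← h, ← Finset.sum_pair (ne_of_mem_edges he)]
      congr 1
      ext w
      simp
    · simp [y, hx]
  rintro (e | w)
  · have h := hcoef e.1
    simpa [e.2] using h
  · have h := hy w.1
    simpa [y, w.2] using h

lemma dual_apply_eq_sum (f : Module.Dual ℝ (T.Edge → ℝ)) (φ : Sym2 (Fin (n + 3)) → ℝ)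
    (hφ : ∀ e : T.Edge, f (Pi.single e 1) = φ e.1) (x : T.Edge → ℝ) :
    f x = ∑ e : T.Edge, x e * φ e.1 := by
  classical
  conv_lhs => rw [← Finset.univ_sum_single x]
  rw [map_sum]
  refine Finset.sum_congr rfl fun e _ => ?_
  rw [← hφ, ← smul_eq_mul, ← map_smul, ← Pi.single_smul]
  simp

/-- A functional that does not distinguish the two perfect matchings of any tile vanishes wherever
the forms of the triangulation do, as its coefficients are sums of two vertex weights. -/
theorem dual_apply_eq_zero (f : Module.Dual ℝ (T.Edge → ℝ)) (φ : Sym2 (Fin (n + 3)) → ℝ)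
    (hφ : ∀ e : T.Edge, f (Pi.single e 1) = φ e.1)
    (h : ∀ i < S.d, φ s(S.old i, S.left (i + 1)) + φ s(S.right (i + 1), S.new i) =
      φ s(S.old i, S.right (i + 1)) + φ s(S.left (i + 1), S.new i))
    (z : T.Edge → ℝ) (hz : ∀ i, (T.triangulationSystem a b).form i z = 0) : f z = 0 := by
  classical
  obtain ⟨y, hy⟩ := S.exists_vertex_weight φ h le_rfl
  have hz0 : ∀ e, e ∉ T.subEdges a b → z e = 0 := fun e he => hz (Sum.inl ⟨e, he⟩)
  have hz1 : ∀ w, (∑ e : T.Edge, if e ∈ T.subEdges a b ∧ w ∈ e.1 then z e else 0) = 0 := by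
    intro w
    by_cases hw : w ∈ T.subVertices a b
    · have := hz (Sum.inr ⟨w, hw⟩)
      simp only [triangulationSystem, Sum.elim_inr, sumForm_apply, Set.mem_ofPred_eq] at this
      convert this
    · exact Finset.sum_eq_zero fun e _ => if_neg fun he => hw (he.1 w he.2)
  have hterm : ∀ e : T.Edge, z e * φ e.1 =
      ∑ w, y w * if e ∈ T.subEdges a b ∧ w ∈ e.1 then z e else 0 := by
    rintro ⟨e, he⟩
    by_cases hs : (⟨e, he⟩ : T.Edge) ∈ T.subEdges a b
    · induction e with | _ u v
      rw [hy u v (S.mem_subEdges.1 hs), mul_comm, add_mul]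
      simp only [hs, true_and, mul_ite, mul_zero, ← Finset.sum_filter]
      rw [← Finset.sum_pair (f := fun w => y w * z ⟨s(u, v), he⟩) (ne_of_mem_edges he)]
      congr 1
      ext w
      simp
    · simp [hz0 _ hs, hs]
  rw [dual_apply_eq_sum f φ hφ, Finset.sum_congr rfl fun e _ => hterm e, Finset.sum_comm]
  refine Finset.sum_eq_zero fun w _ => ?_
  rw [← Finset.mul_sum, hz1, mul_zero]

instance : Finite (T.triangulationSystem a b).Index :=
  inferInstanceAs (Finite ({e : T.Edge // e ∉ T.subEdges a b} ⊕
    {w : Fin (n + 3) // w ∈ T.subVertices a b}))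

theorem card_triangulationSystem_index (S : Strip T a b) :
    Nat.card (T.triangulationSystem a b).Index + S.d = 2 * n + 3 := by
  classical
  change Nat.card ({e : T.Edge // e ∉ T.subEdges a b} ⊕
    {w : Fin (n + 3) // w ∈ T.subVertices a b}) + S.d = _
  have h1 : Nat.card {w : Fin (n + 3) // w ∈ T.subVertices a b} = S.d + 3 := by
    rw [← S.card_verts le_rfl, Nat.card_eq_fintype_card]
    exact Fintype.card_of_subtype _ fun w => S.mem_subVertices.symm
  have h2 : Nat.card {e : T.Edge // e ∈ T.subEdges a b} = 2 * S.d + 3 := by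
    rw [← S.card_sides le_rfl, ← Nat.card_eq_finsetCard]
    exact Nat.card_congr
      ⟨fun e => ⟨e.1.1, S.mem_subEdges.1 e.2⟩,
        fun e => ⟨⟨e.1, ((S.mem_sides le_rfl).1 e.2).1⟩, S.mem_subEdges.2 e.2⟩,
        fun _ => rfl, fun _ => rfl⟩
  have h3 : Nat.card {e : T.Edge // e ∈ T.subEdges a b} +
      Nat.card {e : T.Edge // e ∉ T.subEdges a b} = 2 * n + 3 := by
    rw [← card_edges T, ← Nat.card_eq_finsetCard, ← Nat.card_sum]
    exact Nat.card_congr (Equiv.sumCompl _)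
  rw [Nat.card_sum]
  omega

lemma side_injective {i j : ℕ} (hi : i < S.d) (hj : j < S.d)
    (h : S.side (i + 1) = S.side (j + 1)) : i = j := by
  wlog hij : i ≤ j generalizing i j
  · exact (this hj hi h.symm (by omega)).symm
  · by_contra hne
    obtain ⟨k, rfl⟩ : ∃ k, j = k + 1 := ⟨j - 1, by omega⟩
    refine S.new_notMem_side_of_le (m := k) (j := i + 1) (by omega) (by omega) ?_
    rw [h]
    exact S.new_mem_side (by omega)

lemma ncard_crossed : (T.crossed a b).ncard = S.d := by
  have : T.crossed a b = (fun i => S.side (i + 1)) '' Set.Iio S.d := by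
    ext τ
    rw [S.mem_crossed]
    simp [eq_comm]
  rw [this, Set.InjOn.ncard_image (s := Set.Iio S.d) fun i hi j hj h => S.side_injective hi hj h,
    ← Finset.coe_Iio, Set.ncard_coe_finset, Nat.card_Iio]

end Strip
end SnakePolytope

namespace SnakePolytope
namespace Strip

open Triangulation

variable {n : ℕ} {T : Triangulation n} {a b : Fin (n + 3)} (S : Strip T a b)

/-! ### Corners of tiles and their layers -/

/-- Along `γ` the endpoints of the crossed diagonals move away from `a` on both sides. -/
lemma rung_mono {i j : ℕ} (hij : i ≤ j) (hj : j < S.d) :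
    pos a (S.left (i + 1)) ≤ pos a (S.left (j + 1)) ∧
      pos a (S.right (j + 1)) ≤ pos a (S.right (i + 1)) := by
  induction j, hij using Nat.le_induction with
  | base => exact ⟨le_rfl, le_rfl⟩
  | succ j hij ih =>
    have ih := ih (by omega)
    have e : j + 1 + 1 = j + 2 := rfl
    rcases S.step j hj with ⟨h1, h2, -⟩ | ⟨h1, h2, -⟩ <;> rw [e, h1] <;> omega

lemma eq_of_side_eq {i : ℕ} (hi : i < S.d) {l r : Fin (n + 3)} (h : S.side (i + 1) = s(l, r))
    (hl : sbtw a l b) : l = S.left (i + 1) ∧ r = S.right (i + 1) := by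
  have hp := S.rung_pos hi
  rcases Sym2.eq_iff.1 h with ⟨h1, h2⟩ | ⟨h1, h2⟩
  · exact ⟨h1.symm, h2.symm⟩
  · rw [← h2] at hl
    simp only [sbtw_iff_pos a, pos_self] at hl
    omega

lemma before_iff {i j : ℕ} (hi : i < S.d) (hj : j < S.d) :
    Before a b (S.side (i + 1)) (S.side (j + 1)) ↔ i < j := by
  have hi' := S.rung_pos hi
  have hj' := S.rung_pos hj
  constructor
  · rintro ⟨hne, l, r, l', r', h1, h2, ⟨h3, -⟩, ⟨h5, -⟩, h7, h8⟩
    obtain ⟨rfl, rfl⟩ := S.eq_of_side_eq hi h1 h3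
    obtain ⟨rfl, rfl⟩ := S.eq_of_side_eq hj h2 h5
    by_contra! hji
    have := S.rung_mono hji hi
    simp only [sbtw_iff_pos a, pos_self] at h7 h8
    refine hne ?_
    have hl : S.left (i + 1) = S.left (j + 1) := by
      rw [← pos_inj (o := a)]
      omega
    have hr : S.right (i + 1) = S.right (j + 1) := by
      rw [← pos_inj (o := a)]
      omega
    rw [side, side, hl, hr]
  · intro hij
    have := S.rung_mono hij.le hj
    refine ⟨fun h => hij.ne (S.side_injective hi hj h), _, _, _, _, rfl, rfl, (S.rung i hi).2,
      (S.rung j hj).2, ?_, ?_⟩ <;>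
    · simp only [sbtw_iff_pos a, pos_self]
      omega

lemma consecutive_iff {i j : ℕ} (hi : i < S.d) (hj : j < S.d) :
    T.Consecutive a b (S.side (i + 1)) (S.side (j + 1)) ↔ j = i + 1 := by
  constructor
  · rintro ⟨-, -, hb, hno⟩
    rw [S.before_iff hi hj] at hb
    by_contra hne
    refine hno ⟨S.side (i + 1 + 1), S.mem_crossed.2 ⟨i + 1, by omega, rfl⟩, ?_, ?_⟩
    · rw [S.before_iff hi (by omega)]
      omega
    · rw [S.before_iff (by omega) hj]
      omega
  · rintro rfl
    refine ⟨S.mem_crossed.2 ⟨i, hi, rfl⟩, S.mem_crossed.2 ⟨_, hj, rfl⟩,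
      (S.before_iff hi hj).2 (by omega), ?_⟩
    rintro ⟨σ, hσ, h1, h2⟩
    obtain ⟨k, hk, rfl⟩ := S.mem_crossed.1 hσ
    rw [S.before_iff hi hk] at h1
    rw [S.before_iff hk hj] at h2
    omega

lemma isTriangle_new {i : ℕ} (hi : i < S.d) {x y : Fin (n + 3)} (h : S.side (i + 1) = s(x, y)) :
    T.IsTriangle x y (S.new i) := by
  have he := S.side_mem_edges hi
  have hx := S.edge_new hi (x := x) (by simp [h])
  have hy := S.edge_new hi (x := y) (by simp [h])
  rw [h] at he
  exact ⟨ne_of_mem_edges he, ne_of_mem_edges hy, ne_of_mem_edges hx, he, hy, hx⟩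

lemma isTriangle_old {i : ℕ} (hi : i < S.d) {x y : Fin (n + 3)} (h : S.side (i + 1) = s(x, y)) :
    T.IsTriangle x y (S.old i) := by
  have he := S.side_mem_edges hi
  have hx := S.edge_old hi (x := x) (by simp [h])
  have hy := S.edge_old hi (x := y) (by simp [h])
  rw [h] at he
  rw [Sym2.eq_swap] at hx hy
  exact ⟨ne_of_mem_edges he, ne_of_mem_edges hy, ne_of_mem_edges hx, he, hy, hx⟩

/-- The only triangles of `T` at a crossed diagonal are the two triangles of the strip. -/
lemma isTriangle_apex {i : ℕ} (hi : i < S.d) {x y z : Fin (n + 3)} (hT : T.IsTriangle x y z)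
    (h : S.side (i + 1) = s(x, y)) : z = S.old i ∨ z = S.new i := by
  wlog hxy : x = S.left (i + 1) ∧ y = S.right (i + 1) generalizing x y
  · obtain ⟨h1, h2, h3, h4, h5, h6⟩ := hT
    refine this (x := y) (y := x) ⟨h1.symm, h3, h2, by rwa [Sym2.eq_swap], h6, h5⟩
      (by rw [h, Sym2.eq_swap]) ?_
    rcases Sym2.eq_iff.1 h with ⟨h1, h2⟩ | ⟨h1, h2⟩
    · exact absurd ⟨h1.symm, h2.symm⟩ hxy
    · exact ⟨h1.symm, h2.symm⟩
  · obtain ⟨rfl, rfl⟩ := hxy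
    obtain ⟨h1, h2, h3, h4, h5, h6⟩ := hT
    have hp := S.rung_pos hi
    by_cases hz : sbtw (S.left (i + 1)) z (S.right (i + 1))
    · right
      obtain ⟨n1, n2, n3, n4, -⟩ := S.new_spec hi
      refine apex_unique hz ?_ h6 (by rwa [Sym2.eq_swap]) n3 (by rwa [Sym2.eq_swap])
      simp only [sbtw_iff_pos a]
      omega
    · left
      obtain ⟨n1, n3, n4, -⟩ := S.old_spec hi
      refine apex_unique (x := S.right (i + 1)) (y := S.left (i + 1)) ?_ ?_ h5
        (by rwa [Sym2.eq_swap]) (by rwa [Sym2.eq_swap]) n3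
      · simp only [sbtw_iff_pos a, Ne, ← pos_inj (o := a)] at *
        omega
      · simp only [sbtw_iff_pos a]
        omega

lemma mem_quadVertices {i : ℕ} (hi : i < S.d) {p : Fin (n + 3)} :
    p ∈ T.quadVertices (S.side (i + 1)) ↔ p ∈ S.side (i + 1) ∨ p = S.old i ∨ p = S.new i := by
  constructor
  · rintro ⟨x, y, z, hT, h, rfl | rfl | rfl⟩
    · simp [h]
    · simp [h]
    · exact Or.inr (S.isTriangle_apex hi hT h)
  · rintro (h | rfl | rfl)
    · exact ⟨_, _, _, S.isTriangle_new hi rfl, rfl, (S.mem_side.1 h).imp_right Or.inl⟩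
    · exact ⟨_, _, _, S.isTriangle_old hi rfl, rfl, Or.inr (Or.inr rfl)⟩
    · exact ⟨_, _, _, S.isTriangle_new hi rfl, rfl, Or.inr (Or.inr rfl)⟩

lemma exists_corner {i : ℕ} (hi : i < S.d) {p : Fin (n + 3)}
    (h : p ∈ S.side (i + 1) ∨ p = S.old i ∨ p = S.new i) :
    ∃ c : T.Corner a b, c.tile = S.side (i + 1) ∧ c.point = p :=
  ⟨⟨S.side (i + 1), p, S.mem_crossed.2 ⟨i, hi, rfl⟩, (S.mem_quadVertices hi).2 h⟩, rfl, rfl⟩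

lemma exists_tile (c : T.Corner a b) : ∃ i < S.d, c.tile = S.side (i + 1) :=
  S.mem_crossed.1 c.tile_mem

lemma point_cases {c : T.Corner a b} {i : ℕ} (hi : i < S.d) (h : c.tile = S.side (i + 1)) :
    c.point ∈ S.side (i + 1) ∨ c.point = S.old i ∨ c.point = S.new i := by
  have := c.point_mem
  rwa [h, S.mem_quadVertices hi] at this

open Classical in
/-- The layer of a corner of a tile. The corners on the diagonal of the `k`-th tile are in layer
`k`, its other two corners are in the layers `k - 1` and `k + 1`; so the layer of a corner is an
index `j` such that the corner represents an endpoint of the `j`-th side of the strip. -/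
noncomputable def cornerLevel (c : T.Corner a b) : ℕ :=
  if c.point ∈ S.side ((S.exists_tile c).choose + 1) then (S.exists_tile c).choose + 1
  else if c.point ∈ S.side (S.exists_tile c).choose then (S.exists_tile c).choose
  else (S.exists_tile c).choose + 2

lemma choose_tile {c : T.Corner a b} {i : ℕ} (hi : i < S.d) (h : c.tile = S.side (i + 1)) :
    (S.exists_tile c).choose = i := by
  obtain ⟨h1, h2⟩ := (S.exists_tile c).choose_spec
  exact S.side_injective h1 hi (h2.symm.trans h)

lemma cornerLevel_side {c : T.Corner a b} {i : ℕ} (hi : i < S.d) (h : c.tile = S.side (i + 1))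
    (hp : c.point ∈ S.side (i + 1)) : S.cornerLevel c = i + 1 := by
  rw [cornerLevel, S.choose_tile hi h, if_pos hp]

lemma cornerLevel_old {c : T.Corner a b} {i : ℕ} (hi : i < S.d) (h : c.tile = S.side (i + 1))
    (hp : c.point = S.old i) : S.cornerLevel c = i := by
  rw [cornerLevel, S.choose_tile hi h, hp, if_neg (S.old_notMem_side hi),
    if_pos (S.old_spec hi).2.2.2.1]

lemma cornerLevel_new {c : T.Corner a b} {i : ℕ} (hi : i < S.d) (h : c.tile = S.side (i + 1))
    (hp : c.point = S.new i) : S.cornerLevel c = i + 2 := by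
  rw [cornerLevel, S.choose_tile hi h, hp, if_neg (S.new_notMem_side hi),
    if_neg (S.new_notMem_side_of_le hi (by omega))]

lemma old_eq_of_mem {i : ℕ} (hi : i < S.d) {x : Fin (n + 3)} (hx : x ∈ S.side i)
    (hx' : x ∉ S.side (i + 1)) : x = S.old i :=
  ((S.old_spec hi).2.2.2.2 x hx).resolve_right hx'

/-- Corners that are glued lie in the same layer. -/
lemma cornerLevel_eq_of_glue {c c' : T.Corner a b} (h : Glue c c') :
    S.cornerLevel c = S.cornerLevel c' := by
  obtain ⟨hc, hp, x, y, z, hT, h1, h2, h3⟩ := h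
  obtain ⟨i, hi, hci⟩ := S.exists_tile c
  obtain ⟨j, hj, hcj⟩ := S.exists_tile c'
  rw [hci, hcj, S.consecutive_iff hi hj] at hc
  subst hc
  rw [hci] at h1
  rw [hcj] at h2
  rcases Sym2.mem_iff.1 h3 with h | h
  · rw [S.cornerLevel_side hi hci (by simp [h1, h]), S.cornerLevel_old hj hcj]
    rw [← hp]
    refine S.old_eq_of_mem hj (by simp [h1, h]) ?_
    rw [h2, h]
    simp [hT.1.symm, hT.2.1]
  · rw [S.cornerLevel_side hj hcj (by simp [h2, ← hp, h]), S.cornerLevel_new hi hci]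
    refine (S.mem_side_succ hi (by simp [h2, h])).resolve_right ?_
    rw [h1, h]
    simp [hT.2.1.symm, hT.2.2.1.symm]

lemma glue_of_eq {i : ℕ} (hi : i + 1 < S.d) {c c' : T.Corner a b} (hc : c.tile = S.side (i + 1))
    (hc' : c'.tile = S.side (i + 2)) (hp : c.point = c'.point)
    (h : c.point = S.new i ∨ c.point = S.old (i + 1)) : Glue c c' := by
  have hi' : i < S.d := by omega
  refine ⟨?_, hp, ?_⟩
  · rw [hc, hc']
    exact (S.consecutive_iff hi' hi).2 rfl
  · rw [hc, hc']
    rcases S.old_succ hi with ⟨h1, h2, h3⟩ | ⟨h1, h2, h3⟩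
    · have hs : S.side (i + 1) = s(S.right (i + 1), S.left (i + 1)) := Sym2.eq_swap
      refine ⟨_, _, _, S.isTriangle_new hi' hs, hs, ?_, ?_⟩
      · rw [side, h2, h3, Sym2.eq_swap]
      · rw [← h1, Sym2.mem_iff]
        exact h.symm
    · refine ⟨_, _, _, S.isTriangle_new hi' rfl, rfl, ?_, ?_⟩
      · rw [side, h2, h3]
      · rw [← h1, Sym2.mem_iff]
        exact h.symm

/-! ### The snake graph as a layered graph -/

/-- The layer of a vertex of the snake graph. -/
noncomputable def level : T.SnakeVertex a b → ℕ :=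
  Quot.lift S.cornerLevel fun _ _ h => S.cornerLevel_eq_of_glue h

lemma level_le (u : T.SnakeVertex a b) : S.level u ≤ S.d + 1 := by
  induction u using Quot.ind with | _ c
  obtain ⟨i, hi, hc⟩ := S.exists_tile c
  change S.cornerLevel c ≤ _
  rcases S.point_cases hi hc with h | h | h
  · rw [S.cornerLevel_side hi hc h]
    omega
  · rw [S.cornerLevel_old hi hc h]
    omega
  · rw [S.cornerLevel_new hi hc h]
    omega

lemma mark_mem_side (u : T.SnakeVertex a b) : mark u ∈ S.side (S.level u) := by
  induction u using Quot.ind with | _ c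
  obtain ⟨i, hi, hc⟩ := S.exists_tile c
  change c.point ∈ S.side (S.cornerLevel c)
  rcases S.point_cases hi hc with h | h | h
  · rwa [S.cornerLevel_side hi hc h]
  · rw [S.cornerLevel_old hi hc h, h]
    exact (S.old_spec hi).2.2.2.1
  · rw [S.cornerLevel_new hi hc h, h]
    exact S.new_mem_side hi

/-- Every vertex of the snake graph is a corner of the tile of its own layer; for the vertices at
`a` and `b`, whose layers have no tile, it is the first or the last tile. -/
lemma exists_canonical_corner (c : T.Corner a b) : ∃ c' : T.Corner a b,
    (Quot.mk _ c : T.SnakeVertex a b) = Quot.mk _ c' ∧ c'.point = c.point ∧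
      c'.tile = S.side (max 1 (min (S.cornerLevel c) S.d)) := by
  obtain ⟨i, hi, hc⟩ := S.exists_tile c
  rcases S.point_cases hi hc with h | h | h
  · refine ⟨c, rfl, rfl, ?_⟩
    rw [hc, S.cornerLevel_side hi hc h]
    congr 1
    omega
  · rw [S.cornerLevel_old hi hc h]
    rcases i with _ | i
    · refine ⟨c, rfl, rfl, ?_⟩
      rw [hc]
      congr 1
    · obtain ⟨c', h1, h2⟩ := S.exists_corner (i := i) (by omega)
        (Or.inl (S.old_spec hi).2.2.2.1)
      refine ⟨c', (Quot.sound (S.glue_of_eq hi h1 hc (h2.trans h.symm) (Or.inr h2))).symm,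
        h2.trans h.symm, ?_⟩
      rw [h1]
      congr 1
      omega
  · rw [S.cornerLevel_new hi hc h]
    rcases Nat.lt_or_ge (i + 1) S.d with hi1 | hi1
    · obtain ⟨c', h1, h2⟩ := S.exists_corner hi1 (Or.inl (S.new_mem_side hi))
      refine ⟨c', Quot.sound (S.glue_of_eq hi1 hc h1 (h.trans h2.symm) (Or.inl h)),
        h2.trans h.symm, ?_⟩
      rw [h1]
      congr 1
      omega
    · refine ⟨c, rfl, rfl, ?_⟩
      rw [hc]
      congr 1
      omega

/-- A vertex of the snake graph is determined by its layer and the vertex of the polygon that it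
represents. -/
lemma vertex_ext {u v : T.SnakeVertex a b} (h : S.level u = S.level v) (h' : mark u = mark v) :
    u = v := by
  induction u using Quot.ind with | _ c
  induction v using Quot.ind with | _ c'
  obtain ⟨c₁, h1, h2, h3⟩ := S.exists_canonical_corner c
  obtain ⟨c₂, h4, h5, h6⟩ := S.exists_canonical_corner c'
  change S.cornerLevel c = S.cornerLevel c' at h
  change c.point = c'.point at h'
  rw [h1, h4]
  congr 1
  rw [Triangulation.Corner.mk.injEq]
  exact ⟨by rw [h3, h6, h], by rw [h2, h5, h']⟩

lemma finite_snakeVertex (S : Strip T a b) : Finite (T.SnakeVertex a b) := by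
  refine Finite.of_injective (β := Fin (S.d + 2) × Fin (n + 3))
    (fun u => (⟨S.level u, by have := S.level_le u; omega⟩, mark u)) fun u v h => ?_
  simp only [Prod.mk.injEq, Fin.mk.injEq] at h
  exact S.vertex_ext h.1 h.2

lemma exists_vertex {j : ℕ} (hj : j ≤ S.d + 1) {x : Fin (n + 3)} (hx : x ∈ S.side j) :
    ∃ u : T.SnakeVertex a b, S.level u = j ∧ mark u = x := by
  have hd := S.d_pos
  rcases j with _ | j
  · rw [S.mem_side_zero, ← S.old_zero] at hx
    obtain ⟨c, h1, h2⟩ := S.exists_corner hd (Or.inr (Or.inl hx))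
    exact ⟨Quot.mk _ c, S.cornerLevel_old hd h1 (h2.trans hx), h2⟩
  · rcases Nat.lt_or_ge j S.d with h | h
    · obtain ⟨c, h1, h2⟩ := S.exists_corner h (Or.inl hx)
      exact ⟨Quot.mk _ c, S.cornerLevel_side h h1 (h2 ▸ hx), h2⟩
    · obtain ⟨i, rfl⟩ : ∃ i, j = i + 1 := ⟨j - 1, by omega⟩
      have hi : i < S.d := by omega
      have hid : i + 2 = S.d + 1 := by omega
      have hx' : x = S.new i := by
        have h1 := S.new_mem_side hi
        change x ∈ S.side (i + 2) at hx
        rw [hid, S.mem_side_last] at h1 hx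
        exact hx.trans h1.symm
      obtain ⟨c, h1, h2⟩ := S.exists_corner hi (Or.inr (Or.inr hx'))
      exact ⟨Quot.mk _ c, S.cornerLevel_new hi h1 (h2.trans hx'), h2⟩

lemma adj_new {i : ℕ} (hi : i < S.d) {u v : T.SnakeVertex a b} (hu : S.level u = i + 1)
    (hv : S.level v = i + 2) (h : mark v = S.new i) : (T.snakeGraph a b).Adj u v := by
  have hx := S.mark_mem_side u
  rw [hu] at hx
  obtain ⟨c, h1, h2⟩ := S.exists_corner hi (Or.inl hx)
  obtain ⟨c', h3, h4⟩ := S.exists_corner hi (Or.inr (Or.inr h))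
  obtain ⟨y, hy⟩ := hx
  refine ⟨c, c', h1.trans h3.symm, ⟨_, y, _, S.isTriangle_new hi hy, h1.trans hy, ?_⟩, ?_, ?_⟩
  · rw [h2, h4, h]
  · refine S.vertex_ext ?_ h2.symm
    rw [hu]
    exact (S.cornerLevel_side hi h1 (by rw [h2, hy]; simp)).symm
  · refine S.vertex_ext ?_ h4.symm
    rw [hv]
    exact (S.cornerLevel_new hi h3 (h4.trans h)).symm

lemma adj_old {i : ℕ} (hi : i < S.d) {u v : T.SnakeVertex a b} (hu : S.level u = i)
    (hv : S.level v = i + 1) (h : mark u = S.old i) : (T.snakeGraph a b).Adj u v := by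
  have hx := S.mark_mem_side v
  rw [hv] at hx
  obtain ⟨c, h1, h2⟩ := S.exists_corner hi (Or.inl hx)
  obtain ⟨c', h3, h4⟩ := S.exists_corner hi (Or.inr (Or.inl h))
  obtain ⟨y, hy⟩ := hx
  refine ⟨c', c, h3.trans h1.symm, ⟨_, y, _, S.isTriangle_old hi hy, h3.trans hy, ?_⟩, ?_, ?_⟩
  · rw [h2, h4, h, Sym2.eq_swap]
  · refine S.vertex_ext ?_ h4.symm
    rw [hu]
    exact (S.cornerLevel_old hi h3 (h4.trans h)).symm
  · refine S.vertex_ext ?_ h2.symm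
    rw [hv]
    exact (S.cornerLevel_side hi h1 (by rw [h2, hy]; simp)).symm

/-- Vertices in neighbouring layers that represent different vertices of the polygon are
adjacent. -/
lemma adj_of_level {u v : T.SnakeVertex a b} (h : S.level v = S.level u + 1)
    (hne : mark u ≠ mark v) : (T.snakeGraph a b).Adj u v := by
  have hu := S.mark_mem_side u
  have hv := S.mark_mem_side v
  have hle := S.level_le v
  rcases hj : S.level u with _ | i
  · rw [hj] at h hu
    refine S.adj_old S.d_pos hj h ?_
    rw [S.old_zero]
    exact S.mem_side_zero.1 hu
  · rw [hj] at h hu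
    rw [h] at hv hle
    have hi : i < S.d := by omega
    by_cases hvn : mark v = S.new i
    · exact S.adj_new hi hj h hvn
    · have hv' := (S.mem_side_succ hi hv).resolve_left hvn
      have hn := S.new_mem_side hi
      have hi1 : i + 1 < S.d := by
        by_contra hno
        have hid : i + 1 + 1 = S.d + 1 := by omega
        change S.new i ∈ S.side (i + 1 + 1) at hn
        rw [hid, S.mem_side_last] at hv hn
        exact hvn (hv.trans hn.symm)
      refine S.adj_old hi1 hj h (S.old_eq_of_mem hi1 hu fun hu2 => ?_)
      -- The side has only two endpoints.
      have h3 := S.new_notMem_side hi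
      have h4 : mark u ≠ S.new i := fun h => h3 (h ▸ hu)
      have e : i + 1 + 1 = i + 2 := rfl
      rw [e, mem_side] at hu2 hv
      rw [mem_side] at hn
      grind

lemma mark_ne_of_adj {u v : T.SnakeVertex a b} (h : (T.snakeGraph a b).Adj u v) :
    mark u ≠ mark v := by
  obtain ⟨c, c', -, ⟨x, y, z, hT, -, he⟩, rfl, rfl⟩ := h
  change c.point ≠ c'.point
  rintro h
  rw [h] at he
  rcases Sym2.eq_iff.1 he with ⟨h1, h2⟩ | ⟨h1, h2⟩
  · exact hT.2.2.1 (h1.symm.trans h2)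
  · exact hT.2.2.1 (h2.symm.trans h1)

lemma label_mem_sides {ε : Sym2 (T.SnakeVertex a b)} (h : ε ∈ (T.snakeGraph a b).edgeSet) :
    label ε ∈ S.sides S.d := by
  induction ε with | _ u v
  rw [SimpleGraph.mem_edgeSet] at h
  rw [S.mem_sides le_rfl]
  constructor
  · obtain ⟨c, c', -, ⟨x, y, z, hT, -, he⟩, rfl, rfl⟩ := h
    change s(c.point, c'.point) ∈ T.edges
    rw [he]
    exact hT.2.2.2.2.2
  · intro x hx
    rw [label, Sym2.map_mk, Sym2.mem_iff] at hx
    rcases hx with rfl | rfl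
    · exact S.side_mem_verts le_rfl (S.level_le u) (S.mark_mem_side u)
    · exact S.side_mem_verts le_rfl (S.level_le v) (S.mark_mem_side v)

lemma exists_label_new {i : ℕ} (hi : i < S.d) {x : Fin (n + 3)} (hx : x ∈ S.side (i + 1)) :
    ∃ ε ∈ (T.snakeGraph a b).edgeSet, label ε = s(x, S.new i) := by
  obtain ⟨u, hu, rfl⟩ := S.exists_vertex (by omega) hx
  obtain ⟨v, hv, hv'⟩ := S.exists_vertex (by omega) (S.new_mem_side hi)
  exact ⟨s(u, v), S.adj_new hi hu hv hv', by rw [label, Sym2.map_mk, hv']⟩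

lemma exists_label_old {i : ℕ} (hi : i < S.d) {x : Fin (n + 3)} (hx : x ∈ S.side (i + 1)) :
    ∃ ε ∈ (T.snakeGraph a b).edgeSet, label ε = s(S.old i, x) := by
  obtain ⟨u, hu, rfl⟩ := S.exists_vertex (by omega) hx
  obtain ⟨v, hv, hv'⟩ := S.exists_vertex (by omega) (S.old_spec hi).2.2.2.1
  exact ⟨s(v, u), S.adj_old hi hv hu hv', by rw [label, Sym2.map_mk, hv']⟩

/-- With at least two tiles, every side of the strip is a label; a single tile misses its own
diagonal. -/
lemma exists_label_of_mem_sides (hd : 2 ≤ S.d) {m : ℕ} (hm : m ≤ S.d) {e : Sym2 (Fin (n + 3))}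
    (he : e ∈ S.sides m) : ∃ ε ∈ (T.snakeGraph a b).edgeSet, label ε = e := by
  induction m with
  | zero =>
    simp only [sides, Finset.mem_insert, Finset.mem_singleton] at he
    rcases he with rfl | rfl | rfl
    · have := S.exists_label_old S.d_pos (S.left_mem 1)
      rwa [S.old_zero] at this
    · have := S.exists_label_old S.d_pos (S.right_mem 1)
      rwa [S.old_zero] at this
    · have h1 : 0 + 1 < S.d := by omega
      rcases S.old_succ h1 with ⟨h2, h3, h4⟩ | ⟨h2, h3, h4⟩
      · have := S.exists_label_old h1 (S.right_mem (0 + 2))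
        rwa [h2, h4] at this
      · have := S.exists_label_old h1 (S.left_mem (0 + 2))
        rw [h2, h3, Sym2.eq_swap] at this
        exact this
  | succ m ih =>
    simp only [sides, Finset.mem_insert] at he
    rcases he with rfl | rfl | he
    · exact S.exists_label_new hm (S.left_mem _)
    · exact S.exists_label_new hm (S.right_mem _)
    · exact ih (by omega) he

lemma snakeLabels_subset (S : Strip T a b) : T.snakeLabels a b ⊆ T.subEdges a b := by
  rintro e ⟨ε, hε, h⟩
  rw [S.mem_subEdges, ← h]
  exact S.label_mem_sides hε

lemma snakeLabels_eq (hd : 2 ≤ S.d) : T.snakeLabels a b = T.subEdges a b :=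
  S.snakeLabels_subset.antisymm fun _ he =>
    S.exists_label_of_mem_sides hd le_rfl (S.mem_subEdges.1 he)

lemma mark_mem_subVertices (S : Strip T a b) (u : T.SnakeVertex a b) : mark u ∈ T.subVertices a b :=
  S.mem_subVertices.2 (S.side_mem_verts le_rfl (S.level_le u) (S.mark_mem_side u))

/-- A vertex of the polygon is represented once for each side of the strip that contains it, which
is to say once for each diagonal in `γ ∪ D(γ)` at it: the degenerate sides stand for `γ`. -/
lemma ncard_mark_eq (S : Strip T a b) (w : Fin (n + 3)) :
    {u : T.SnakeVertex a b | mark u = w}.ncard = (T.diagonalsAt a b w).ncard := by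
  classical
  have h1 : S.level '' {u : T.SnakeVertex a b | mark u = w} = {j | j ≤ S.d + 1 ∧ w ∈ S.side j} := by
    ext j
    constructor
    · rintro ⟨u, rfl, rfl⟩
      exact ⟨S.level_le u, S.mark_mem_side u⟩
    · rintro ⟨hj, hw⟩
      obtain ⟨u, hu, rfl⟩ := S.exists_vertex hj hw
      exact ⟨u, rfl, hu⟩
  let δ : ℕ → Sym2 (Fin (n + 3)) := fun j => if j = 0 ∨ j = S.d + 1 then s(a, b) else S.side j
  have hδ : ∀ i < S.d, δ (i + 1) = S.side (i + 1) := fun i hi => if_neg (by omega)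
  have hab := S.a_ne_b
  have h2 : δ '' {j | j ≤ S.d + 1 ∧ w ∈ S.side j} = T.diagonalsAt a b w := by
    ext e
    constructor
    · rintro ⟨j, ⟨hj, hw⟩, rfl⟩
      rcases j with _ | j
      · exact ⟨Or.inl rfl, by simp [δ, S.mem_side_zero.1 hw]⟩
      · rcases Nat.lt_or_ge j S.d with h | h
        · rw [hδ j h]
          exact ⟨Or.inr (S.mem_crossed.2 ⟨j, h, rfl⟩), hw⟩
        · obtain rfl : j = S.d := by omega
          exact ⟨Or.inl (by simp [δ]), by simp [δ, S.mem_side_last.1 hw]⟩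
    · rintro ⟨rfl | he, hw⟩
      · rcases Sym2.mem_iff.1 hw with rfl | rfl
        · exact ⟨0, ⟨by omega, S.mem_side_zero.2 rfl⟩, by simp [δ]⟩
        · exact ⟨S.d + 1, ⟨by omega, S.mem_side_last.2 rfl⟩, by simp [δ]⟩
      · obtain ⟨i, hi, rfl⟩ := S.mem_crossed.1 he
        exact ⟨i + 1, ⟨by omega, hw⟩, hδ i hi⟩
  have hside : ∀ i < S.d, S.side (i + 1) ≠ s(a, b) := by
    intro i hi h
    have hp := S.rung_pos hi
    have : a ∈ S.side (i + 1) := by simp [h]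
    rw [mem_side, ← pos_inj (o := a), ← pos_inj (o := a), pos_self] at this
    omega
  have h3 : Set.InjOn δ {j | j ≤ S.d + 1 ∧ w ∈ S.side j} := by
    rintro i ⟨hi, hwi⟩ j ⟨hj, hwj⟩ h
    by_cases hi' : i = 0 ∨ i = S.d + 1 <;> by_cases hj' : j = 0 ∨ j = S.d + 1
    · rcases hi' with rfl | rfl <;> rcases hj' with rfl | rfl
      · rfl
      · exact absurd ((S.mem_side_zero.1 hwi).symm.trans (S.mem_side_last.1 hwj)) hab
      · exact absurd ((S.mem_side_zero.1 hwj).symm.trans (S.mem_side_last.1 hwi)) hab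
      · rfl
    · obtain ⟨k, rfl⟩ : ∃ k, j = k + 1 := ⟨j - 1, by omega⟩
      rw [hδ k (by omega)] at h
      simp only [δ, if_pos hi'] at h
      exact absurd h.symm (hside k (by omega))
    · obtain ⟨k, rfl⟩ : ∃ k, i = k + 1 := ⟨i - 1, by omega⟩
      rw [hδ k (by omega)] at h
      simp only [δ, if_pos hj'] at h
      exact absurd h (hside k (by omega))
    · obtain ⟨k, rfl⟩ : ∃ k, i = k + 1 := ⟨i - 1, by omega⟩
      obtain ⟨k', rfl⟩ : ∃ k, j = k + 1 := ⟨j - 1, by omega⟩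
      rw [hδ k (by omega), hδ k' (by omega)] at h
      rw [S.side_injective (by omega) (by omega) h]
  rw [← h2, h3.ncard_image, ← h1, Set.InjOn.ncard_image]
  intro u hu v hv h
  exact S.vertex_ext h (hu.trans hv.symm)

end Strip
end SnakePolytope

namespace SnakePolytope
namespace Strip

open Triangulation

variable {n : ℕ} {T : Triangulation n} {a b : Fin (n + 3)} (S : Strip T a b)

/-! ### Perfect matchings -/

/-- Double counting: each vertex over `w` lies on exactly one edge of a perfect matching, and each
edge whose label contains `w` has exactly one endpoint over `w`. -/
lemma ncard_matching_edges {M : (T.snakeGraph a b).Subgraph}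
    (hM : M.IsPerfectMatching) (w : Fin (n + 3)) :
    {ε | ε ∈ M.edgeSet ∧ w ∈ label ε}.ncard = {u : T.SnakeVertex a b | mark u = w}.ncard := by
  have hex : ∀ u, ∃ v, M.Adj u v := fun u => (hM.1 (hM.2 u)).exists
  choose p hp using hex
  have himg : {ε | ε ∈ M.edgeSet ∧ w ∈ label ε} =
      (fun u => s(u, p u)) '' {u : T.SnakeVertex a b | mark u = w} := by
    ext ε
    constructor
    · rintro ⟨hε, hw⟩
      induction ε with | _ u v
      rw [SimpleGraph.Subgraph.mem_edgeSet] at hε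
      rw [label, Sym2.map_mk, Sym2.mem_iff] at hw
      rcases hw with rfl | rfl
      · exact ⟨u, rfl, congrArg (s(u, ·)) ((hM.1 (hM.2 u)).unique (hp u) hε)⟩
      · exact ⟨v, rfl, (congrArg (s(v, ·)) ((hM.1 (hM.2 v)).unique (hp v) hε.symm)).trans
          Sym2.eq_swap⟩
    · rintro ⟨u, rfl, rfl⟩
      exact ⟨hp u, by rw [label, Sym2.map_mk]; simp⟩
  rw [himg, Set.InjOn.ncard_image]
  intro u hu v hv h
  rcases Sym2.eq_iff.1 h with ⟨h1, -⟩ | ⟨-, h2⟩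
  · exact h1
  · refine absurd ?_ (mark_ne_of_adj (hp u).adj_sub)
    rw [h2]
    exact hu.trans hv.symm

/-- The characteristic vectors of perfect matchings satisfy the equations of the triangulation. -/
theorem charVector_mem_solutions (S : Strip T a b) {M : (T.snakeGraph a b).Subgraph}
    (hM : M.IsPerfectMatching) : charVector M ∈ (T.triangulationSystem a b).solutions := by
  classical
  have := S.finite_snakeVertex
  rintro (e | w)
  · change ((_ : ℕ) : ℝ) = 0
    rw [Nat.cast_eq_zero, Set.ncard_eq_zero (Set.toFinite _), Set.eq_empty_iff_forall_notMem]
    rintro ε ⟨hε, h⟩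
    exact e.2 (S.snakeLabels_subset ⟨ε, M.edgeSet_subset hε, h⟩)
  · change T.sumForm {e | e ∈ T.subEdges a b ∧ w.1 ∈ e.1} (charVector M) =
      ((T.diagonalsAt a b w.1).ncard : ℝ)
    rw [← S.ncard_mark_eq, ← ncard_matching_edges hM, sumForm, LinearMap.sum_apply]
    have hproj : ∀ e : T.Edge, LinearMap.proj (R := ℝ) (φ := fun _ : T.Edge => ℝ) e
        (charVector M) = (({ε | ε ∈ M.edgeSet ∧ label ε = e.1}.ncard : ℕ) : ℝ) := fun _ => rfl
    simp only [hproj]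
    rw [← Nat.cast_sum, Nat.cast_inj]
    have hmem : ∀ ε ∈ M.edgeSet, label ε ∈ S.sides S.d := fun ε hε =>
      S.label_mem_sides (M.edgeSet_subset hε)
    let f : Sym2 (T.SnakeVertex a b) → T.Edge := fun ε =>
      if h : label ε ∈ T.edges then ⟨label ε, h⟩ else ⟨_, S.start_left⟩
    have hf : ∀ ε ∈ M.edgeSet, (f ε).1 = label ε := fun ε hε => by
      simp [f, ((S.mem_sides le_rfl).1 (hmem ε hε)).1]
    rw [Set.ncard_eq_toFinset_card _ (Set.toFinite _), Finset.card_eq_sum_card_fiberwise (f := f)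
      (t := Finset.univ.filter fun e => e ∈ {e | e ∈ T.subEdges a b ∧ w.1 ∈ e.1})]
    · refine Finset.sum_congr (by ext; simp) fun e he => ?_
      rw [← Set.ncard_coe_finset]
      congr 1
      ext ε
      simp only [Finset.coe_filter, Set.Finite.mem_toFinset, Set.mem_ofPred_eq, Finset.mem_filter,
        Finset.mem_univ, true_and] at he ⊢
      constructor
      · rintro ⟨hε, h⟩
        exact ⟨⟨hε, h ▸ he.2⟩, Subtype.ext ((hf ε hε).trans h)⟩
      · rintro ⟨⟨hε, -⟩, rfl⟩
        exact ⟨hε, (hf ε hε).symm⟩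
    · intro ε hε
      simp only [Set.Finite.coe_toFinset, Set.mem_ofPred_eq] at hε
      simp only [Finset.coe_filter, Finset.mem_univ, true_and, Set.mem_ofPred_eq, S.mem_subEdges,
        hf ε hε.1]
      exact ⟨hmem ε hε.1, hε.2⟩

/-- A perfect matching uses exactly one edge between each two consecutive layers: from the vertex
over `out j` in layer `j` to the vertex over `inn (j + 1)` in layer `j + 1`. -/
def layerMatching (inn out : ℕ → Fin (n + 3)) (hne : ∀ j ≤ S.d, out j ≠ inn (j + 1)) :
    (T.snakeGraph a b).Subgraph where
  verts := Set.univ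
  Adj u v := (S.level v = S.level u + 1 ∧ mark u = out (S.level u) ∧ mark v = inn (S.level v)) ∨
    (S.level u = S.level v + 1 ∧ mark v = out (S.level v) ∧ mark u = inn (S.level u))
  adj_sub := by
    have key : ∀ u v, S.level v = S.level u + 1 → mark u = out (S.level u) →
        mark v = inn (S.level v) → (T.snakeGraph a b).Adj u v := by
      intro u v h hu hv
      refine S.adj_of_level h ?_
      rw [hu, hv, h]
      refine hne _ ?_
      have := S.level_le v
      omega
    rintro u v (⟨h, hu, hv⟩ | ⟨h, hv, hu⟩)
    · exact key u v h hu hv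
    · exact (key v u h hv hu).symm
  edge_vert _ := Set.mem_univ _
  symm := ⟨fun _ _ h => h.symm⟩

variable {inn out : ℕ → Fin (n + 3)} (hne : ∀ j ≤ S.d, out j ≠ inn (j + 1))
  (hio : ∀ j ≤ S.d + 1, S.side j = s(inn j, out j))

include hio in
lemma layerMatching_isPerfectMatching : (S.layerMatching inn out hne).IsPerfectMatching := by
  have hd := S.d_pos
  have hin : ∀ j ≤ S.d + 1, inn j ∈ S.side j := fun j hj => by simp [hio j hj]
  have hout : ∀ j ≤ S.d + 1, out j ∈ S.side j := fun j hj => by simp [hio j hj]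
  have hdiff : ∀ i < S.d, inn (i + 1) ≠ out (i + 1) := by
    intro i hi h
    have h1 := not_isDiag_of_mem_edges (S.side_mem_edges hi)
    rw [hio _ (by omega), h] at h1
    simp at h1
  refine ⟨fun u _ => ?_, fun u => Set.mem_univ u⟩
  have hle := S.level_le u
  by_cases hu : S.level u ≤ S.d ∧ mark u = out (S.level u)
  · obtain ⟨v, hv, hv'⟩ := S.exists_vertex (j := S.level u + 1) (by omega) (hin _ (by omega))
    refine ⟨v, Or.inl ⟨hv, hu.2, by rw [hv, hv']⟩, ?_⟩
    rintro v' (⟨h1, h2, h3⟩ | ⟨h1, h2, h3⟩)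
    · exact S.vertex_ext (h1.trans hv.symm) (by rw [h3, h1, hv'])
    · refine absurd ?_ (hdiff (S.level v') (by omega))
      rw [← h1, ← h3, hu.2]
  · have hmark : mark u = inn (S.level u) ∧ 0 < S.level u := by
      have hm := S.mark_mem_side u
      rcases hj : S.level u with _ | j
      · rw [hj, S.mem_side_zero] at hm
        have := hout 0 (by omega)
        rw [S.mem_side_zero] at this
        exact absurd ⟨by omega, by rw [hj, hm, this]⟩ hu
      · refine ⟨?_, by omega⟩
        rw [hj] at hm hle
        rcases Nat.lt_or_ge j S.d with h | h
        · rw [hio _ hle, Sym2.mem_iff] at hm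
          refine hm.resolve_right fun h' => hu ⟨by omega, by rw [hj, h']⟩
        · obtain rfl : j = S.d := by omega
          have := hin _ hle
          rw [S.mem_side_last] at this hm
          rw [hm, this]
    obtain ⟨hm, hpos⟩ := hmark
    obtain ⟨j, hj⟩ : ∃ j, S.level u = j + 1 := ⟨S.level u - 1, by omega⟩
    obtain ⟨v, hv, hv'⟩ := S.exists_vertex (j := j) (by omega) (hout _ (by omega))
    refine ⟨v, Or.inr ⟨by rw [hv, hj], by rw [hv, hv'], hm⟩, ?_⟩
    rintro v' (⟨h1, h2, h3⟩ | ⟨h1, h2, h3⟩)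
    · refine absurd ⟨?_, h2⟩ hu
      have := S.level_le v'
      omega
    · have : S.level v' = j := by omega
      exact S.vertex_ext (this.trans hv.symm) (by rw [h2, this, hv'])

include hio in
/-- A linear functional on the characteristic vector of a layered matching is the sum of its
values at the labels of the `d + 1` edges. -/
lemma dual_charVector (f : Module.Dual ℝ (T.Edge → ℝ)) (φ : Sym2 (Fin (n + 3)) → ℝ)
    (hφ : ∀ e : T.Edge, f (Pi.single e 1) = φ e.1) :
    f (charVector (S.layerMatching inn out hne)) =
      ∑ j ∈ Finset.range (S.d + 1), φ s(out j, inn (j + 1)) := by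
  classical
  have hexu : ∀ j, ∃ u : T.SnakeVertex a b, j ≤ S.d → S.level u = j ∧ mark u = out j := by
    intro j
    by_cases hj : j ≤ S.d
    · obtain ⟨u, hu⟩ := S.exists_vertex (j := j) (x := out j) (by omega)
        (by simp [hio j (by omega)])
      exact ⟨u, fun _ => hu⟩
    · obtain ⟨u, -⟩ := S.exists_vertex (j := 0) (by omega) (S.left_mem 0)
      exact ⟨u, fun h => absurd h hj⟩
  have hexv : ∀ j, ∃ u : T.SnakeVertex a b, j ≤ S.d → S.level u = j + 1 ∧
      mark u = inn (j + 1) := by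
    intro j
    by_cases hj : j ≤ S.d
    · obtain ⟨u, hu⟩ := S.exists_vertex (j := j + 1) (x := inn (j + 1)) (by omega)
        (by simp [hio (j + 1) (by omega)])
      exact ⟨u, fun _ => hu⟩
    · obtain ⟨u, -⟩ := S.exists_vertex (j := 0) (by omega) (S.left_mem 0)
      exact ⟨u, fun h => absurd h hj⟩
  choose u hu using hexu
  choose v hv using hexv
  have hlab : ∀ j ≤ S.d, label s(u j, v j) = s(out j, inn (j + 1)) := by
    intro j hj
    rw [label, Sym2.map_mk, (hu j hj).2, (hv j hj).2]
  have hadj : ∀ j ≤ S.d, (S.layerMatching inn out hne).Adj (u j) (v j) := by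
    intro j hj
    obtain ⟨h1, h2⟩ := hu j hj
    obtain ⟨h3, h4⟩ := hv j hj
    exact Or.inl ⟨by rw [h1, h3], by rw [h1, h2], by rw [h3, h4]⟩
  have hedge : ∀ j ≤ S.d, s(out j, inn (j + 1)) ∈ T.edges := by
    intro j hj
    rw [← hlab j hj]
    exact ((S.mem_sides le_rfl).1 (S.label_mem_sides (hadj j hj).adj_sub)).1
  have hchar : ∀ e : T.Edge, charVector (S.layerMatching inn out hne) e =
      ∑ j ∈ Finset.range (S.d + 1), if s(out j, inn (j + 1)) = e.1 then (1 : ℝ) else 0 := by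
    intro e
    rw [Finset.sum_boole, charVector]
    congr 1
    have himg : {ε | ε ∈ (S.layerMatching inn out hne).edgeSet ∧ label ε = e.1} =
        (fun j => s(u j, v j)) ''
          ↑((Finset.range (S.d + 1)).filter fun j => s(out j, inn (j + 1)) = e.1) := by
      ext ε
      simp only [Finset.coe_filter, Finset.mem_range, Set.mem_image, Set.mem_ofPred_eq]
      constructor
      · rintro ⟨hε, h⟩
        have key : ∀ x y, S.level y = S.level x + 1 → mark x = out (S.level x) →
            mark y = inn (S.level y) → S.level x ≤ S.d ∧
              s(u (S.level x), v (S.level x)) = s(x, y) := by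
          intro x y hxy hx hy
          have hle : S.level x ≤ S.d := by
            have := S.level_le y
            omega
          obtain ⟨h1, h2⟩ := hu _ hle
          obtain ⟨h3, h4⟩ := hv _ hle
          refine ⟨hle, ?_⟩
          rw [S.vertex_ext h1 (h2.trans hx.symm), S.vertex_ext (h3.trans hxy.symm)
            (by rw [h4, hy, hxy])]
        induction ε with | _ x y
        rcases hε with ⟨h1, h2, h3⟩ | ⟨h1, h2, h3⟩
        · obtain ⟨h4, h5⟩ := key x y h1 h2 h3
          exact ⟨S.level x, ⟨by omega, by rw [← hlab _ h4, h5, h]⟩, h5⟩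
        · obtain ⟨h4, h5⟩ := key y x h1 h2 h3
          rw [Sym2.eq_swap] at h
          exact ⟨S.level y, ⟨by omega, by rw [← hlab _ h4, h5, h]⟩, by rw [h5, Sym2.eq_swap]⟩
      · rintro ⟨j, ⟨hj, h⟩, rfl⟩
        exact ⟨hadj j (by omega), by rw [hlab j (by omega), h]⟩
    rw [himg, Set.InjOn.ncard_image, Set.ncard_coe_finset]
    intro i hi j hj h
    simp only [Finset.coe_filter, Finset.mem_range, Set.mem_ofPred_eq] at hi hj
    obtain ⟨h1, -⟩ := hu i (by omega)
    obtain ⟨h2, -⟩ := hu j (by omega)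
    obtain ⟨h3, -⟩ := hv i (by omega)
    obtain ⟨h4, -⟩ := hv j (by omega)
    rcases Sym2.eq_iff.1 h with ⟨h5, -⟩ | ⟨h5, h6⟩
    · rw [← h1, ← h2, h5]
    · rw [h5] at h1
      rw [h6] at h3
      omega
  rw [dual_apply_eq_sum f φ hφ]
  simp only [hchar, Finset.sum_mul]
  rw [Finset.sum_comm]
  refine Finset.sum_congr rfl fun j hj => ?_
  rw [Finset.mem_range] at hj
  rw [Finset.sum_eq_single ⟨_, hedge j (by omega)⟩]
  · simp
  · intro e _ he
    rw [if_neg fun h => he (Subtype.ext h.symm), zero_mul]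
  · simp

/-- The endpoint of the `j`-th side other than `x`. -/
def otherEnd (j : ℕ) (x : Fin (n + 3)) : Fin (n + 3) :=
  if x = S.left j then S.right j else S.left j

lemma side_eq_otherEnd {j : ℕ} {x : Fin (n + 3)} (hx : x ∈ S.side j) :
    S.side j = s(x, S.otherEnd j x) := by
  by_cases h : x = S.left j
  · rw [otherEnd, if_pos h, h, side]
  · rw [otherEnd, if_neg h, (S.mem_side.1 hx).resolve_left h, side, Sym2.eq_swap]

/-- The left ends `out j` of the edges of a layered matching that contains two opposite sides of
the tile with diagonal `side (i + 1)`; that diagonal is left through its endpoint `x`. The edges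
in front of the tile start in a vertex `old j`, which is not on the next side, and those behind
it end in a vertex `new j`, which is not on the side before, so the two ends of an edge never
represent the same vertex. Both choices of `x` give the same matching away from the tile. -/
def outSeq (i : ℕ) (x : Fin (n + 3)) (j : ℕ) : Fin (n + 3) :=
  if j ≤ i then S.old j else if j = i + 1 then x else S.otherEnd j (S.new (j - 2))

/-- The right ends `inn j` of the edges of the matching given by `outSeq`. -/
def innSeq (i : ℕ) (x : Fin (n + 3)) (j : ℕ) : Fin (n + 3) :=
  if j ≤ i then S.otherEnd j (S.old j) else if j = i + 1 then S.otherEnd j x else S.new (j - 2)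

lemma side_eq_seq {i : ℕ} (hi : i < S.d) {x : Fin (n + 3)} (hx : x ∈ S.side (i + 1)) {j : ℕ}
    (hj : j ≤ S.d + 1) : S.side j = s(S.innSeq i x j, S.outSeq i x j) := by
  unfold innSeq outSeq
  split_ifs with h1 h2
  · rw [Sym2.eq_swap]
    exact S.side_eq_otherEnd (S.old_spec (by omega)).2.2.2.1
  · rw [Sym2.eq_swap]
    exact S.side_eq_otherEnd (h2 ▸ hx)
  · refine S.side_eq_otherEnd ?_
    obtain ⟨k, rfl⟩ : ∃ k, j = k + 2 := ⟨j - 2, by omega⟩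
    exact S.new_mem_side (by omega)

lemma outSeq_ne_innSeq {i : ℕ} (hi : i < S.d) {x : Fin (n + 3)} (hx : x ∈ S.side (i + 1)) {j : ℕ}
    (hj : j ≤ S.d) : S.outSeq i x j ≠ S.innSeq i x (j + 1) := by
  have h1 : S.innSeq i x (j + 1) ∈ S.side (j + 1) := by
    rw [S.side_eq_seq hi hx (by omega)]
    simp
  have h2 : S.outSeq i x j ∈ S.side j := by
    rw [S.side_eq_seq hi hx (by omega)]
    simp
  by_cases hji : j ≤ i
  · intro h
    rw [← h, outSeq, if_pos hji] at h1
    exact S.old_notMem_side (by omega) h1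
  · intro h
    obtain ⟨k, rfl⟩ : ∃ k, j = k + 1 := ⟨j - 1, by omega⟩
    rw [h, innSeq, if_neg (by omega), if_neg (by omega)] at h2
    exact S.new_notMem_side (by omega) h2

/-- A functional that is constant on the perfect matchings has vanishing alternating sum around
every tile, since there are two perfect matchings that differ only in that tile. -/
theorem tile_relation (f : Module.Dual ℝ (T.Edge → ℝ)) (φ : Sym2 (Fin (n + 3)) → ℝ)
    (hφ : ∀ e : T.Edge, f (Pi.single e 1) = φ e.1)
    (hf : ∀ M M' : (T.snakeGraph a b).Subgraph, M.IsPerfectMatching → M'.IsPerfectMatching →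
      f (charVector M) = f (charVector M')) {i : ℕ} (hi : i < S.d) :
    φ s(S.old i, S.left (i + 1)) + φ s(S.right (i + 1), S.new i) =
      φ s(S.old i, S.right (i + 1)) + φ s(S.left (i + 1), S.new i) := by
  have hL := S.left_mem (i + 1)
  have hR := S.right_mem (i + 1)
  have hLR := S.left_ne_right hi
  have h := hf _ _
    (S.layerMatching_isPerfectMatching (fun j => S.outSeq_ne_innSeq hi hL)
      fun j => S.side_eq_seq hi hL)
    (S.layerMatching_isPerfectMatching (fun j => S.outSeq_ne_innSeq hi hR)
      fun j => S.side_eq_seq hi hR)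
  rw [S.dual_charVector _ (fun j => S.side_eq_seq hi hL) f φ hφ,
    S.dual_charVector _ (fun j => S.side_eq_seq hi hR) f φ hφ, ← sub_eq_zero,
    ← Finset.sum_sub_distrib, ← Finset.sum_subset (s₁ := {i, i + 1}),
    Finset.sum_pair (by omega)] at h
  · simp only [outSeq, innSeq, otherEnd, le_refl, if_true, if_false, hLR.symm,
      show ¬ i + 1 ≤ i by omega, show ¬ i + 1 + 1 ≤ i by omega,
      show ¬ i + 1 + 1 = i + 1 by omega, show i + 1 + 1 - 2 = i by omega] at h
    linarith
  · intro j hj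
    simp only [Finset.mem_insert, Finset.mem_singleton] at hj
    rw [Finset.mem_range]
    omega
  · intro j _ hj
    simp only [Finset.mem_insert, Finset.mem_singleton, not_or] at hj
    rw [sub_eq_zero]
    congr 1
    have h1 : S.outSeq i (S.left (i + 1)) j = S.outSeq i (S.right (i + 1)) j := by
      simp [outSeq, hj.2]
    have h2 : S.innSeq i (S.left (i + 1)) (j + 1) = S.innSeq i (S.right (i + 1)) (j + 1) := by
      simp [innSeq, hj.1]
    rw [h1, h2]

lemma exists_isPerfectMatching (S : Strip T a b) :
    ∃ M : (T.snakeGraph a b).Subgraph, M.IsPerfectMatching :=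
  ⟨_, S.layerMatching_isPerfectMatching (fun _ => S.outSeq_ne_innSeq S.d_pos (S.left_mem 1))
    fun _ => S.side_eq_seq S.d_pos (S.left_mem 1)⟩

theorem affineSpan_eq_triangulationSystem (S : Strip T a b) :
    (affineSpan ℝ (T.matchingPolytope a b) : Set (T.Edge → ℝ)) =
      (T.triangulationSystem a b).solutions := by
  classical
  rw [matchingPolytope, affineSpan_convexHull]
  have hsub : {x | ∃ M : (T.snakeGraph a b).Subgraph, M.IsPerfectMatching ∧ x = charVector M} ⊆
      (T.triangulationSystem a b).solutions := by
    rintro _ ⟨M, hM, rfl⟩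
    exact S.charVector_mem_solutions hM
  refine (LinearSystem.affineSpan_subset_solutions hsub).antisymm
    (LinearSystem.solutions_subset_affineSpan hsub ?_ fun f hf z hz => ?_)
  · obtain ⟨M, hM⟩ := S.exists_isPerfectMatching
    exact ⟨_, M, hM, rfl⟩
  · let φ : Sym2 (Fin (n + 3)) → ℝ := fun e =>
      if h : e ∈ T.edges then f (Pi.single ⟨e, h⟩ 1) else 0
    have hφ : ∀ e : T.Edge, f (Pi.single e 1) = φ e.1 := fun e => by simp [φ, e.2]
    exact S.dual_apply_eq_zero f φ hφ (fun i hi => S.tile_relation f φ hφ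
      (fun M M' hM hM' => hf _ ⟨M, hM, rfl⟩ _ ⟨M', hM', rfl⟩) hi) z hz

/-! ### The equations of the snake graph -/

lemma members_eq (u : T.SnakeVertex a b) :
    VertexClass.members (⟦u⟧ : T.VertexClass a b) = {v | mark v = mark u} := by
  ext v
  exact Quotient.eq

/-- The labels at a vertex class are all labels that contain the represented vertex. -/
lemma labels_eq (u : T.SnakeVertex a b) :
    VertexClass.labels (⟦u⟧ : T.VertexClass a b) =
      {e | e ∈ T.snakeLabels a b ∧ mark u ∈ e.1} := by
  ext e
  simp only [VertexClass.labels, members_eq, Set.mem_ofPred_eq]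
  constructor
  · rintro ⟨v, hv, ε, ⟨hε, hvε⟩, h⟩
    refine ⟨⟨ε, hε, h⟩, ?_⟩
    rw [← h, ← hv]
    exact Sym2.mem_map.2 ⟨v, hvε, rfl⟩
  · rintro ⟨⟨ε, hε, h⟩, hu⟩
    rw [← h] at hu
    obtain ⟨v, hv, hvu⟩ := Sym2.mem_map.1 hu
    exact ⟨v, hvu, ε, ⟨hε, hv⟩, h⟩

/-- The vertex classes correspond to the vertices of `T'`. -/
noncomputable def classEquiv :
    T.VertexClass a b ≃ {w : Fin (n + 3) // w ∈ T.subVertices a b} :=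
  Equiv.ofBijective
    (Quotient.lift (fun u => ⟨mark u, S.mark_mem_subVertices u⟩) fun _ _ h => Subtype.ext h) <| by
    constructor
    · intro C C' h
      induction C using Quotient.ind with | _ u
      induction C' using Quotient.ind with | _ v
      exact Quotient.sound (congrArg Subtype.val h)
    · rintro ⟨w, hw⟩
      obtain ⟨j, hj, hwj⟩ := (S.mem_verts le_rfl).1 (S.mem_subVertices.1 hw)
      obtain ⟨u, -, rfl⟩ := S.exists_vertex hj hwj
      exact ⟨⟦u⟧, rfl⟩

lemma charVector_eq_zero (M : (T.snakeGraph a b).Subgraph) {e : T.Edge}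
    (he : e ∉ T.snakeLabels a b) : charVector M e = 0 := by
  have : {ε | ε ∈ M.edgeSet ∧ label ε = e.1} = ∅ := by
    rw [Set.eq_empty_iff_forall_notMem]
    rintro ε ⟨hε, h⟩
    exact he ⟨ε, M.edgeSet_subset hε, h⟩
  simp [charVector, this]

/-- On vectors that vanish off the labels of the snake graph the two systems have the same
equations. -/
lemma sumForm_snakeLabels_eq (S : Strip T a b) {x : T.Edge → ℝ}
    (hx : ∀ e, e ∉ T.snakeLabels a b → x e = 0) (w : Fin (n + 3)) :
    T.sumForm {e | e ∈ T.snakeLabels a b ∧ w ∈ e.1} x =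
      T.sumForm {e | e ∈ T.subEdges a b ∧ w ∈ e.1} x := by
  classical
  rw [sumForm_apply, sumForm_apply]
  refine Finset.sum_congr rfl fun e _ => ?_
  by_cases he : e ∈ T.snakeLabels a b
  · simp [he, S.snakeLabels_subset he]
  · simp [hx e he]

theorem triangulationSystem_solutions_eq (S : Strip T a b) :
    (T.triangulationSystem a b).solutions = (T.snakeSystem a b).solutions := by
  ext x
  constructor
  · intro hx
    -- The span of the matchings lies in the hyperplanes given by the edges that are no labels.
    have hx0 : ∀ e, e ∉ T.snakeLabels a b → x e = 0 := by
      intro e he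
      have hmem := hx
      rw [← S.affineSpan_eq_triangulationSystem, matchingPolytope, affineSpan_convexHull] at hmem
      let L : LinearSystem (T.Edge → ℝ) := ⟨Unit, fun _ => LinearMap.proj e, fun _ => 0⟩
      refine LinearSystem.affineSpan_subset_solutions (L := L) ?_ hmem ()
      rintro _ ⟨M, -, rfl⟩ -
      exact charVector_eq_zero M he
    rintro (e | C)
    · exact hx0 e.1 e.2
    · induction C using Quotient.ind with | _ u
      have h := hx (Sum.inr ⟨mark u, S.mark_mem_subVertices u⟩)
      simp only [triangulationSystem, snakeSystem, Sum.elim_inr] at h ⊢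
      rw [labels_eq, members_eq, S.sumForm_snakeLabels_eq hx0, S.ncard_mark_eq, h]
  · intro hx
    have hx0 : ∀ e, e ∉ T.snakeLabels a b → x e = 0 := fun e he => hx (Sum.inl ⟨e, he⟩)
    rintro (e | w)
    · exact hx0 e.1 fun h => e.2 (S.snakeLabels_subset h)
    · obtain ⟨w, hw⟩ := w
      obtain ⟨C, hC⟩ := S.classEquiv.surjective ⟨w, hw⟩
      induction C using Quotient.ind with | _ u
      obtain rfl : mark u = w := congrArg Subtype.val hC
      have h := hx (Sum.inr ⟦u⟧)
      simp only [triangulationSystem, snakeSystem, Sum.elim_inr] at h ⊢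
      rw [labels_eq, members_eq, S.sumForm_snakeLabels_eq hx0, S.ncard_mark_eq] at h
      exact h

/-- With at least two tiles the two systems consist of the same equations. -/
noncomputable def indexEquiv (hd : 2 ≤ S.d) :
    (T.snakeSystem a b).Index ≃ (T.triangulationSystem a b).Index :=
  Equiv.sumCongr (Equiv.subtypeEquivRight fun e => by rw [S.snakeLabels_eq hd]) S.classEquiv

lemma form_indexEquiv (hd : 2 ≤ S.d) (i : (T.snakeSystem a b).Index) :
    (T.snakeSystem a b).form i = (T.triangulationSystem a b).form (S.indexEquiv hd i) := by
  rcases i with e | C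
  · rfl
  · induction C using Quotient.ind with | _ u
    change T.sumForm _ = T.sumForm _
    rw [labels_eq, S.snakeLabels_eq hd]
    rfl

end Strip
end SnakePolytope

theorem mainTheorem4 (n : ℕ) (T : SnakePolytope.Triangulation n) (a b : Fin (n + 3))
    (hγ : SnakePolytope.IsDiagonal s(a, b)) (hγT : s(a, b) ∉ T.diagonals) :
    Nat.card T.Edge = 2 * n + 3 ∧
    (affineSpan ℝ (T.matchingPolytope a b) : Set (T.Edge → ℝ)) = (T.snakeSystem a b).solutions ∧
    (affineSpan ℝ (T.matchingPolytope a b) : Set (T.Edge → ℝ)) =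
      (T.triangulationSystem a b).solutions ∧
    ((T.triangulationSystem a b).Independent ∧ (T.triangulationSystem a b).Irredundant ∧
      Finite (T.triangulationSystem a b).Index ∧
      Nat.card (T.triangulationSystem a b).Index + (T.crossed a b).ncard = 2 * n + 3) ∧
    (2 ≤ (T.crossed a b).ncard →
      (T.snakeSystem a b).Independent ∧ (T.snakeSystem a b).Irredundant ∧
      Finite (T.snakeSystem a b).Index ∧
      Nat.card (T.snakeSystem a b).Index + (T.crossed a b).ncard = 2 * n + 3) := by
  obtain ⟨S⟩ := SnakePolytope.exists_strip hγ hγT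
  have hind := S.triangulationSystem_independent
  have hne : (T.triangulationSystem a b).solutions.Nonempty := by
    obtain ⟨M, hM⟩ := S.exists_isPerfectMatching
    exact ⟨_, S.charVector_mem_solutions hM⟩
  have hspan := S.affineSpan_eq_triangulationSystem
  rw [S.ncard_crossed]
  refine ⟨?_, hspan.trans S.triangulationSystem_solutions_eq, hspan,
    ⟨hind, hind.irredundant hne, inferInstance, S.card_triangulationSystem_index⟩, fun hd => ?_⟩
  · rw [Nat.card_eq_finsetCard, T.card_edges]
  · have hfin : Finite (T.snakeSystem a b).Index := Finite.of_equiv _ (S.indexEquiv hd).symm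
    have hind' := hind.of_equiv (S.indexEquiv hd) (S.form_indexEquiv hd)
    refine ⟨hind', hind'.irredundant (S.triangulationSystem_solutions_eq ▸ hne), hfin, ?_⟩
    rw [Nat.card_congr (S.indexEquiv hd), S.card_triangulationSystem_index]
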